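/- Let $f,g:\mathbb{R}\to\mathbb{R}$ be bounded and non-decreasing. On $L^2(\mathbb{R})$ let $P=-i\,d/dx$ and let $Q$ be multiplication by $x$, so that $g(Q)$ is multiplication by $g$ and $f(P)$ is multiplication by $f$ conjugated by the unitary Fourier transform. Suppose that the bounded operator $C = i[f(P),g(Q)] = i\,(f(P)g(Q)-g(Q)f(P))$ is positive, i.e. $C\ge 0$. Let $df$ be the finite Lebesgue–Stieltjes measure of the right-continuous version of $f$, let $$\widehat{df}(u)=\frac{1}{\sqrt{2\pi}}\int_{\mathbb{R}} e^{-iu\xi}\,df(\xi),$$ and for a bounded monotone function $h$ write $[h]=\lim_{x\to\infty}h(x)-\lim_{x\to-\infty}h(x)$. Define, for $x\ne y$ (the diagonal has measure zero), $$K(x,y)=\frac{1}{\sqrt{2\pi}}\,\frac{g(x)-g(y)}{x-y}\,\widehat{df}(y-x).$$ Then: 1. for every $\psi\in L^2(\mathbb{R})$ and almost every $x\in\mathbb{R}$, the function $y\mapsto K(x,y)\psi(y)$ is integrable and $(C\psi)(x)=\int_{\mathbb{R}}K(x,y)\psi(y)\,dy$; 2. $K$ is square-integrable on $\mathbb{R}^2$;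 3. $C$ is trace class and $\operatorname{tr} C=[f][g]/(2\pi)$. -/

import Mathlib

open MeasureTheory Filter Topology
open scoped ENNReal InnerProductSpace

noncomputable section

/-- The complex Hilbert space `L²(ℝ)`. -/
abbrev L2R : Type := Lp ℂ 2 (volume : Measure ℝ)

/-- A bounded measurable real function, viewed as a complex one, is essentially bounded. -/
theorem memLp_top_ofReal {h : ℝ → ℝ} (hm : Measurable h) (hb : ∃ M, ∀ x, |h x| ≤ M) :
    MemLp (fun x => (h x : ℂ)) ∞ (volume : Measure ℝ) := by
  obtain ⟨M, hM⟩ := hb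
  refine memLp_top_of_bound (Complex.measurable_ofReal.comp hm).aestronglyMeasurable M ?_
  exact Eventually.of_forall fun x => by simpa using hM x

/-- For a bounded measurable real function `g`, the operator `g(Q)` on `L²(ℝ)`, where `Q` is
multiplication by `x`: it is multiplication by the function `g`. -/
def funQ (g : ℝ → ℝ) (hm : Measurable g) (hb : ∃ M, ∀ x, |g x| ≤ M) : L2R →L[ℂ] L2R :=
  (ContinuousLinearMap.mul ℂ ℂ).holderL volume ∞ 2 2 (memLp_top_ofReal hm hb).toLp

theorem funQ_apply (g : ℝ → ℝ) (hm : Measurable g) (hb : ∃ M, ∀ x, |g x| ≤ M) (ψ : L2R) :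
    funQ g hm hb ψ =ᵐ[volume] fun x => (g x : ℂ) * ψ x := by
  refine ((ContinuousLinearMap.mul ℂ ℂ).coeFn_holder (r := 2)
    (memLp_top_ofReal hm hb).toLp ψ).trans ?_
  filter_upwards [(memLp_top_ofReal hm hb).coeFn_toLp] with x hx
  simp [hx]

/-- For a bounded measurable real function `f`, the operator `f(P)` on `L²(ℝ)`, where
`P = -i d/dx`. The unitary Fourier transform `𝓕 ψ (ξ) = ∫ ψ(x) e^{-2πixξ} dx` turns `P` into
multiplication by `2πξ`, so `f(P) = 𝓕⁻¹ ∘ (multiplication by f(2πξ)) ∘ 𝓕`. -/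
def funP (f : ℝ → ℝ) (hm : Measurable f) (hb : ∃ M, ∀ x, |f x| ≤ M) : L2R →L[ℂ] L2R :=
  ((Lp.fourierTransformₗᵢ ℝ ℂ).symm : L2R →L[ℂ] L2R) ∘L
    funQ (fun ξ => f (2 * Real.pi * ξ)) (hm.comp (measurable_const_mul (2 * Real.pi)))
      (hb.imp fun _ hM ξ => hM (2 * Real.pi * ξ)) ∘L
    ((Lp.fourierTransformₗᵢ ℝ ℂ) : L2R →L[ℂ] L2R)

/-- The operator `i[f(P), g(Q)]`. -/
def iCommutator (f g : ℝ → ℝ) (hfm : Measurable f) (hfb : ∃ M, ∀ x, |f x| ≤ M)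
    (hgm : Measurable g) (hgb : ∃ M, ∀ x, |g x| ≤ M) : L2R →L[ℂ] L2R :=
  Complex.I • (funP f hfm hfb ∘L funQ g hgm hgb - funQ g hgm hgb ∘L funP f hfm hfb)

/-- The Fourier transform `(2π)^{-1/2} ∫ e^{-iuξ} df(ξ)` of the Lebesgue–Stieltjes measure `df`
of a non-decreasing function `f` (i.e. of its right-continuous version). -/
def dfHat {f : ℝ → ℝ} (hf : Monotone f) (u : ℝ) : ℂ :=
  ((Real.sqrt (2 * Real.pi))⁻¹ : ℝ) *
    ∫ ξ, Complex.exp (-Complex.I * u * ξ) ∂hf.stieltjesFunction.measure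

/-- The kernel `K(x,y) = (2π)^{-1/2} (g(x) - g(y)) / (x - y) · (df)^(y - x)`. -/
def commKernel {f : ℝ → ℝ} (hf : Monotone f) (g : ℝ → ℝ) (x y : ℝ) : ℂ :=
  ((Real.sqrt (2 * Real.pi))⁻¹ : ℝ) * ((g x - g y) / (x - y) : ℝ) * dfHat hf (y - x)

/-- The total increment `[h] = h(∞) - h(-∞)`. -/
def increment (h : ℝ → ℝ) : ℝ := limUnder atTop h - limUnder atBot h

/-- A bounded operator `T` on a Hilbert space is trace class if `∑ ⟪eᵢ, |T| eᵢ⟫ < ∞` for every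
orthonormal (Hilbert) basis `e`, where `|T| = (T* T)^{1/2}`. -/
def IsTraceClass {H : Type*} [NormedAddCommGroup H] [InnerProductSpace ℂ H] [CompleteSpace H]
    (T : H →L[ℂ] H) : Prop :=
  ∀ (s : Set H) (e : HilbertBasis s ℂ H), Summable fun i => ⟪e i, CFC.abs T (e i)⟫_ℂ

/-- `T` has trace `t`: for every Hilbert basis `e`, `∑ ⟪eᵢ, T eᵢ⟫` converges to `t`. -/
def HasTrace {H : Type*} [NormedAddCommGroup H] [InnerProductSpace ℂ H] [CompleteSpace H]
    (T : H →L[ℂ] H) (t : ℂ) : Prop :=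
  ∀ (s : Set H) (e : HilbertBasis s ℂ H), HasSum (fun i => ⟪e i, T (e i)⟫_ℂ) t

end

/-! Kernel. If `f` were integrable, `f(P)` would be convolution with an inverse Fourier transform
and the commutator would visibly have a kernel. In general, subtract a translate: `f(P) - f(P + n)`
has an integrable symbol, and Fubini for `dξ ⊗ df` shows that its commutator has kernel `K(x,y) (1 -
e^{-in(x-y)})`. As `n → ∞`, `f(P + n)` tends strongly to the scalar `f(∞)`, so its commutator with
`g(Q)` tends strongly to zero, while the oscillating part of the kernel dies by Riemann–Lebesgue.
The limit is `iCommutator_ae_eq`, first on `L¹ ∩ L²`, then on `L²` by truncation. The integrals make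
sense because `g` is differentiable almost everywhere, so that almost every section `K(x, ·)` is in
`L²`.

Trace. Let `S = √C`. For any Hilbert basis, `∑ ‖S eᵢ‖²` equals the integral of `‖S φ‖²` over the
packets `φ` (unit box moved to `q`, modulated by `p`), because these resolve the identity
(`tsum_enorm_sq_eq_lintegral_packetLp`). Here `‖S φ‖² = ⟪φ, C φ⟫`. Averaging over `q` replaces the
slope of `g` in `K` by the constant `[g]` (`integral_slope_translate`); what is left is an integral
of `|𝓕 box|²` against `df`, and integrating over `p` gives `[f]` by Plancherel. Positivity of `C`
makes every exchange involving the sum and `p` an instance of Tonelli, and gives `|C| = C`.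

Square integrability. `C = S ∘ S` is Hilbert–Schmidt since `‖C eᵢ‖ ≤ ‖S‖ ‖S eᵢ‖`, and Parseval on
sections identifies its Hilbert–Schmidt norm with the `L²` norm of `K`. -/

section

open FourierTransform SchwartzMap

/-! ### The `L²` Fourier transform as an integral -/

/-- An `L²` function is determined by its integrals against Schwartz functions. -/
theorem L2R_ae_eq_of_schwartz (u : L2R) {v : ℝ → ℂ} (hv : LocallyIntegrable v)
    (h : ∀ θ : 𝓢(ℝ, ℂ), ∫ x, θ x • u x = ∫ x, θ x • v x) : u =ᵐ[volume] v := by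
  refine ae_eq_of_integral_contDiff_smul_eq ((Lp.memLp u).locallyIntegrable (by norm_num)) hv ?_
  intro θ hθ hc
  have hc' : HasCompactSupport (Complex.ofRealCLM ∘ θ) := hc.comp_left rfl
  have hθ' : ContDiff ℝ ((⊤ : ℕ∞) : WithTop ℕ∞) (Complex.ofRealCLM ∘ θ) :=
    Complex.ofRealCLM.contDiff.comp hθ
  simpa using h (hc'.toSchwartzMap hθ')

/-- On `L¹ ∩ L²` the Fourier transform of `L²` is the Fourier integral. -/
theorem L2R_fourier_ae_eq (ψ : L2R) (hψ : Integrable ψ) :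
    Lp.fourierTransformₗᵢ ℝ ℂ ψ =ᵐ[volume] 𝓕 (ψ : ℝ → ℂ) := by
  refine L2R_ae_eq_of_schwartz _ ?_ fun θ => ?_
  · refine Continuous.locallyIntegrable ?_
    exact VectorFourier.fourierIntegral_continuous Real.continuous_fourierChar continuous_inner hψ
  · have h1 := congrArg (fun T => T θ) (Lp.fourier_toTemperedDistribution_eq ψ)
    simp only [TemperedDistribution.fourier_apply, Lp.toTemperedDistribution_apply] at h1
    refine h1.symm.trans ?_
    have h2 := VectorFourier.integral_fourierIntegral_smul_eq_flip (μ := volume) (ν := volume)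
      (L := innerₗ ℝ) Real.continuous_fourierChar continuous_inner θ.integrable hψ
    rw [flip_innerₗ] at h2
    exact h2

/-- On `L¹ ∩ L²` the inverse Fourier transform of `L²` is the inverse Fourier integral. -/
theorem L2R_fourierInv_ae_eq (ψ : L2R) (hψ : Integrable ψ) :
    (Lp.fourierTransformₗᵢ ℝ ℂ).symm ψ =ᵐ[volume] 𝓕⁻ (ψ : ℝ → ℂ) := by
  refine L2R_ae_eq_of_schwartz _ ?_ fun θ => ?_
  · refine Continuous.locallyIntegrable ?_
    exact VectorFourier.fourierIntegral_continuous Real.continuous_fourierChar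
      continuous_inner.neg hψ
  · have h1 := congrArg (fun T => T θ) (Lp.fourierInv_toTemperedDistribution_eq ψ)
    simp only [TemperedDistribution.fourierInv_apply, Lp.toTemperedDistribution_apply] at h1
    refine h1.symm.trans ?_
    have h2 := VectorFourier.integral_fourierIntegral_smul_eq_flip (μ := volume) (ν := volume)
      (L := -innerₗ ℝ) Real.continuous_fourierChar (continuous_inner.neg)
      θ.integrable hψ
    have h3 : (-innerₗ ℝ : ℝ →ₗ[ℝ] ℝ →ₗ[ℝ] ℝ).flip = -innerₗ ℝ := by ext; simp
    rw [h3] at h2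
    rw [SchwartzMap.fourierInv_coe]
    exact h2

theorem enorm_L2R_sq (ψ : L2R) : ‖ψ‖ₑ ^ 2 = ∫⁻ x, ‖ψ x‖ₑ ^ 2 := by
  rw [Lp.enorm_def, eLpNorm_eq_lintegral_rpow_enorm_toReal (by norm_num) (by norm_num),
    ← ENNReal.rpow_natCast, ← ENNReal.rpow_mul]
  norm_num

/-- Plancherel's theorem on `L¹ ∩ L²`. -/
theorem lintegral_enorm_fourier_sq {u : ℝ → ℂ} (h1 : Integrable u) (h2 : MemLp u 2) :
    ∫⁻ ξ, ‖𝓕 u ξ‖ₑ ^ 2 = ∫⁻ x, ‖u x‖ₑ ^ 2 := by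
  have hu := h2.coeFn_toLp
  have e1 : ∫⁻ x, ‖u x‖ₑ ^ 2 = ‖h2.toLp‖ₑ ^ 2 := by
    rw [enorm_L2R_sq]
    exact lintegral_congr_ae (hu.mono fun x hx => by simp only [hx])
  have e2 : 𝓕 u = 𝓕 (h2.toLp : ℝ → ℂ) := by
    ext ξ
    exact integral_congr_ae (hu.mono fun x hx => by simp only [hx])
  rw [e1, e2, ← (Lp.fourierTransformₗᵢ ℝ ℂ).enorm_map, enorm_L2R_sq]
  refine lintegral_congr_ae ?_
  filter_upwards [L2R_fourier_ae_eq h2.toLp (h1.congr hu.symm)] with x hx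
  rw [hx]

end

/-! ### Bounded monotone functions and their Stieltjes measures -/

theorem Monotone.ae_eq_stieltjesFunction {f : ℝ → ℝ} (hf : Monotone f) :
    ∀ᵐ x, f x = hf.stieltjesFunction x := by
  filter_upwards [hf.countable_not_continuousAt.ae_notMem volume] with x hx
  have hx' : ContinuousAt f x := by simpa using hx
  rw [hf.stieltjesFunction_eq]
  exact ((hf.continuousWithinAt_Ioi_iff_rightLim_eq).1 hx'.continuousWithinAt).symm

theorem Monotone.tendsto_limUnder_atTop {f : ℝ → ℝ} (hf : Monotone f)
    (hb : ∃ M, ∀ x, |f x| ≤ M) : Tendsto f atTop (𝓝 (limUnder atTop f)) := by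
  obtain ⟨M, hM⟩ := hb
  refine tendsto_nhds_limUnder ⟨_, tendsto_atTop_ciSup hf ⟨M, ?_⟩⟩
  rintro _ ⟨x, rfl⟩
  exact (abs_le.1 (hM x)).2

theorem Monotone.tendsto_limUnder_atBot {f : ℝ → ℝ} (hf : Monotone f)
    (hb : ∃ M, ∀ x, |f x| ≤ M) : Tendsto f atBot (𝓝 (limUnder atBot f)) := by
  obtain ⟨M, hM⟩ := hb
  refine tendsto_nhds_limUnder ⟨_, tendsto_atBot_ciInf hf ⟨-M, ?_⟩⟩
  rintro _ ⟨x, rfl⟩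
  exact (abs_le.1 (hM x)).1

theorem increment_nonneg {f : ℝ → ℝ} (hf : Monotone f) (hb : ∃ M, ∀ x, |f x| ≤ M) :
    0 ≤ increment f :=
  sub_nonneg.2 ((hf.le_of_tendsto (hf.tendsto_limUnder_atBot hb) 0).trans
    (hf.ge_of_tendsto (hf.tendsto_limUnder_atTop hb) 0))

/-- Squeezing `f x ≤ f(x+) ≤ f (x + 1)`, the right-continuous version has the same limits at `±∞` as
`f`. -/
theorem stieltjes_measure_univ {f : ℝ → ℝ} (hf : Monotone f) (hb : ∃ M, ∀ x, |f x| ≤ M) :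
    hf.stieltjesFunction.measure Set.univ = ENNReal.ofReal (increment f) := by
  have h1 : ∀ x, f x ≤ hf.stieltjesFunction x := fun x => hf.le_rightLim le_rfl
  have h2 : ∀ x, hf.stieltjesFunction x ≤ f (x + 1) := fun x => hf.rightLim_le (by linarith)
  have hT := hf.tendsto_limUnder_atTop hb
  have hB := hf.tendsto_limUnder_atBot hb
  refine StieltjesFunction.measure_univ _ ?_ ?_
  · exact tendsto_of_tendsto_of_tendsto_of_le_of_le hB
      (hB.comp (tendsto_atBot_add_const_right _ 1 tendsto_id)) h1 h2
  · exact tendsto_of_tendsto_of_tendsto_of_le_of_le hT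
      (hT.comp (tendsto_atTop_add_const_right _ 1 tendsto_id)) h1 h2

theorem isFiniteMeasure_stieltjes {f : ℝ → ℝ} (hf : Monotone f) (hb : ∃ M, ∀ x, |f x| ≤ M) :
    IsFiniteMeasure hf.stieltjesFunction.measure :=
  ⟨by rw [stieltjes_measure_univ hf hb]; exact ENNReal.ofReal_lt_top⟩

theorem stieltjes_measureReal_univ {f : ℝ → ℝ} (hf : Monotone f) (hb : ∃ M, ∀ x, |f x| ≤ M) :
    hf.stieltjesFunction.measure.real Set.univ = increment f := by
  rw [measureReal_def, stieltjes_measure_univ hf hb,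
    ENNReal.toReal_ofReal (increment_nonneg hf hb)]

/-- Integrating the increments `f (ξ + c) - f ξ` of a bounded monotone function against a bounded
function `φ`, by Fubini's theorem for `dξ ⊗ df`. -/
theorem integral_sub_mul_eq {f : ℝ → ℝ} (hf : Monotone f) (hb : ∃ M, ∀ x, |f x| ≤ M)
    {c : ℝ} (hc : 0 ≤ c) {φ : ℝ → ℂ} (hφ : Measurable φ) (hφ1 : ∀ x, ‖φ x‖ ≤ 1) :
    Integrable (fun ξ => ((f (ξ + c) - f ξ : ℝ) : ℂ) * φ ξ) ∧
    ∫ ξ, ((f (ξ + c) - f ξ : ℝ) : ℂ) * φ ξ =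
      ∫ η, (∫ ξ in Set.Ico (η - c) η, φ ξ) ∂hf.stieltjesFunction.measure := by
  have := isFiniteMeasure_stieltjes hf hb
  set μ := hf.stieltjesFunction.measure with hμ
  -- The strip has sections `(ξ, ξ + c]`, whose `df`-mass is the increment of the right-continuous
  -- version even if `df` has atoms, and sections `[η - c, η)` of length `c`.
  let S : Set (ℝ × ℝ) := {p | p.1 < p.2 ∧ p.2 ≤ p.1 + c}
  have hS : MeasurableSet S :=
    (measurableSet_lt measurable_fst measurable_snd).inter
      (measurableSet_le measurable_snd (measurable_fst.add_const c))
  have hSη : ∀ η, (fun ξ => (ξ, η)) ⁻¹' S = Set.Ico (η - c) η := by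
    intro η; ext ξ
    simp only [S, Set.mem_preimage, Set.mem_ofPred_eq, Set.mem_Ico]
    constructor <;> rintro ⟨h1, h2⟩ <;> constructor <;> linarith
  have hSξ : ∀ ξ, Prod.mk ξ ⁻¹' S = Set.Ioc ξ (ξ + c) := by
    intro ξ; ext η
    simp [S]
  have hfin : (volume.prod μ) S ≠ ∞ := by
    rw [Measure.prod_apply_symm hS]
    simp only [hSη, Real.volume_Ico, sub_sub_cancel, lintegral_const]
    exact ENNReal.mul_ne_top ENNReal.ofReal_ne_top (measure_ne_top _ _)
  have hF : Integrable (S.indicator fun p => φ p.1) (volume.prod μ) := by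
    rw [integrable_indicator_iff hS]
    refine Measure.integrableOn_of_bounded hfin
      (hφ.comp measurable_fst).aestronglyMeasurable (M := 1) ?_
    exact Eventually.of_forall fun p => hφ1 _
  have hin : ∀ᵐ ξ, (∫ η, S.indicator (fun p => φ p.1) (ξ, η) ∂μ) =
      ((f (ξ + c) - f ξ : ℝ) : ℂ) * φ ξ := by
    have hae := hf.ae_eq_stieltjesFunction
    have hae' : ∀ᵐ ξ, f (ξ + c) = hf.stieltjesFunction (ξ + c) :=
      (measurePreserving_add_right volume c).quasiMeasurePreserving.ae hae
    filter_upwards [hae, hae'] with ξ h1 h2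
    have : (fun η => S.indicator (fun p => φ p.1) (ξ, η)) =
        (Set.Ioc ξ (ξ + c)).indicator fun _ => φ ξ := by
      ext η
      rw [← hSξ ξ]
      rfl
    rw [this, integral_indicator measurableSet_Ioc, setIntegral_const, measureReal_def, hμ,
      StieltjesFunction.measure_Ioc, ← h1, ← h2,
      ENNReal.toReal_ofReal (sub_nonneg.2 (hf (by linarith)))]
    simp
  have hout : ∀ η, (∫ ξ, S.indicator (fun p => φ p.1) (ξ, η)) = ∫ ξ in Set.Ico (η - c) η, φ ξ := by
    intro η
    rw [← integral_indicator measurableSet_Ico, ← hSη η]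
    rfl
  refine ⟨hF.integral_prod_left.congr hin, ?_⟩
  rw [← integral_congr_ae hin, integral_integral_swap (f := fun ξ η => S.indicator (fun p => φ p.1) (ξ, η)) hF]
  simp only [hout]

/-- The case `φ = 1`: each `η` contributes the length `c`, so the total is `c` times the mass of
`df`. -/
theorem integral_sub_translate {f : ℝ → ℝ} (hf : Monotone f) (hb : ∃ M, ∀ x, |f x| ≤ M)
    {c : ℝ} (hc : 0 ≤ c) :
    Integrable (fun ξ => f (ξ + c) - f ξ) ∧ ∫ ξ, (f (ξ + c) - f ξ) = increment f * c := by
  have := isFiniteMeasure_stieltjes hf hb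
  obtain ⟨h1, h2⟩ := integral_sub_mul_eq hf hb hc (φ := fun _ => 1) measurable_const (by simp)
  simp only [mul_one] at h1 h2
  refine ⟨by simpa using h1.re, ?_⟩
  rw [integral_complex_ofReal] at h2
  apply Complex.ofReal_injective
  rw [h2]
  simp [hc, stieltjes_measureReal_univ hf hb]

/-! ### Size and regularity of the kernel -/

theorem norm_dfHat_le {f : ℝ → ℝ} (hf : Monotone f) (hb : ∃ M, ∀ x, |f x| ≤ M) (u : ℝ) :
    ‖dfHat hf u‖ ≤ (Real.sqrt (2 * Real.pi))⁻¹ * increment f := by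
  have := isFiniteMeasure_stieltjes hf hb
  unfold dfHat
  rw [norm_mul, Complex.norm_real, Real.norm_of_nonneg (by positivity)]
  gcongr
  refine (norm_integral_le_of_norm_le_const (C := 1) (Eventually.of_forall fun ξ => ?_)).trans ?_
  · rw [Complex.norm_exp]; simp
  · rw [one_mul, stieltjes_measureReal_univ hf hb]

theorem continuous_dfHat {f : ℝ → ℝ} (hf : Monotone f) (hb : ∃ M, ∀ x, |f x| ≤ M) :
    Continuous (dfHat hf) := by
  have := isFiniteMeasure_stieltjes hf hb
  unfold dfHat
  refine continuous_const.mul ?_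
  refine continuous_of_dominated (bound := fun _ => 1) ?_ ?_ (integrable_const _) ?_
  · intro u
    exact (by fun_prop : Continuous _).aestronglyMeasurable
  · intro u
    refine Eventually.of_forall fun ξ => ?_
    rw [Complex.norm_exp]; simp
  · exact Eventually.of_forall fun ξ => by fun_prop

theorem measurable_commKernel {f g : ℝ → ℝ} (hf : Monotone f) (hb : ∃ M, ∀ x, |f x| ≤ M)
    (hg : Measurable g) : Measurable fun p : ℝ × ℝ => commKernel hf g p.1 p.2 := by
  unfold commKernel
  have := (continuous_dfHat hf hb).measurable
  fun_prop

/-- The difference quotients at a point of differentiability of a bounded function are square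
integrable. -/
theorem memLp_slope {g : ℝ → ℝ} (hg : Measurable g) (hb : ∃ M, ∀ x, |g x| ≤ M) {x : ℝ}
    (hx : DifferentiableAt ℝ g x) : MemLp (fun y => (g x - g y) / (x - y)) 2 := by
  obtain ⟨M, hM⟩ := hb
  have hM0 : 0 ≤ M := (abs_nonneg _).trans (hM 0)
  obtain ⟨B, hB⟩ := hx.isBigO_sub.bound
  obtain ⟨δ, hδ, hδB⟩ := Metric.eventually_nhds_iff.1 hB
  have hB0 : ∀ y, |x - y| < δ → |g x - g y| ≤ |B| * |x - y| := by
    intro y hy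
    have := hδB (y := y) (by rwa [Real.dist_eq, abs_sub_comm])
    rw [Real.norm_eq_abs, Real.norm_eq_abs, abs_sub_comm, abs_sub_comm y] at this
    exact this.trans (mul_le_mul_of_nonneg_right (le_abs_self B) (abs_nonneg _))
  rw [memLp_two_iff_integrable_sq (by fun_prop : Measurable _).aestronglyMeasurable]
  -- The first summand bounds the squared quotient times `1 + (x - y)²` for `|x - y| < δ`, by
  -- differentiability; the second for `|x - y| ≥ δ`, by `|g| ≤ M`.
  set D := B ^ 2 * (1 + δ ^ 2) + 4 * M ^ 2 * (1 + 1 / δ ^ 2) with hD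
  have hint : Integrable fun y : ℝ => D * (1 + (x - y) ^ 2)⁻¹ :=
    (integrable_inv_one_add_sq.comp_sub_left x).const_mul D
  refine hint.mono' (by fun_prop : Measurable _).aestronglyMeasurable
    (Eventually.of_forall fun y => ?_)
  rw [Real.norm_of_nonneg (sq_nonneg _), ← div_eq_mul_inv, div_pow]
  rcases eq_or_ne x y with rfl | hxy
  · simp; positivity
  have hpos : 0 < (x - y) ^ 2 := by positivity [sub_ne_zero.2 hxy]
  rw [div_le_div_iff₀ hpos (by positivity)]
  have e0 : 0 ≤ 1 / δ ^ 2 := by positivity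
  rcases lt_or_ge |x - y| δ with h | h
  · have h1 : (g x - g y) ^ 2 ≤ B ^ 2 * (x - y) ^ 2 := by
      rw [← mul_pow, ← sq_abs, ← sq_abs (B * (x - y)), abs_mul]
      exact pow_le_pow_left₀ (abs_nonneg _) (hB0 y h) 2
    have h2 : (x - y) ^ 2 ≤ δ ^ 2 := by
      rw [← sq_abs]; exact pow_le_pow_left₀ (abs_nonneg _) h.le 2
    calc (g x - g y) ^ 2 * (1 + (x - y) ^ 2) ≤ (B ^ 2 * (x - y) ^ 2) * (1 + δ ^ 2) := by gcongr
      _ ≤ D * (x - y) ^ 2 := by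
        rw [hD]
        nlinarith [mul_nonneg (mul_nonneg (by positivity : 0 ≤ 4 * M ^ 2)
          (by positivity : 0 ≤ 1 + 1 / δ ^ 2)) hpos.le]
  · have h1 : (g x - g y) ^ 2 ≤ 4 * M ^ 2 := by
      have a := abs_le.1 (hM x)
      have b := abs_le.1 (hM y)
      have : |g x - g y| ≤ 2 * M := abs_le.2 ⟨by linarith, by linarith⟩
      rw [← sq_abs]
      nlinarith [abs_nonneg (g x - g y)]
    have h2 : δ ^ 2 ≤ (x - y) ^ 2 := by
      rw [← sq_abs (x - y)]; exact pow_le_pow_left₀ hδ.le h 2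
    have h3 : 1 + (x - y) ^ 2 ≤ (1 + 1 / δ ^ 2) * (x - y) ^ 2 := by
      have : 1 ≤ 1 / δ ^ 2 * (x - y) ^ 2 := by
        rw [one_div, inv_mul_eq_div, le_div_iff₀ (by positivity)]; linarith
      linarith
    calc (g x - g y) ^ 2 * (1 + (x - y) ^ 2)
        ≤ (4 * M ^ 2) * ((1 + 1 / δ ^ 2) * (x - y) ^ 2) := by gcongr
      _ ≤ D * (x - y) ^ 2 := by
        rw [hD]
        nlinarith [mul_nonneg (mul_nonneg (sq_nonneg B)
          (by positivity : 0 ≤ 1 + δ ^ 2)) hpos.le]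

/-- For almost every `x` the section `K(x, ·)` of the kernel is square integrable. -/
theorem ae_memLp_commKernel {f g : ℝ → ℝ} (hf : Monotone f) (hfb : ∃ M, ∀ x, |f x| ≤ M)
    (hg : Monotone g) (hgb : ∃ M, ∀ x, |g x| ≤ M) :
    ∀ᵐ x, MemLp (fun y => commKernel hf g x y) 2 := by
  -- By Lebesgue's theorem almost every `x` is a point of differentiability; there the slope is in
  -- `L²` and `dfHat` is a bounded factor.
  filter_upwards [hg.ae_differentiableAt] with x hx
  have h1 := (memLp_slope hg.measurable hgb hx).const_mul
    ((Real.sqrt (2 * Real.pi))⁻¹ * ((Real.sqrt (2 * Real.pi))⁻¹ * increment f))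
  refine h1.of_le ((measurable_commKernel hf hfb hg.measurable).comp
    measurable_prodMk_left).aestronglyMeasurable (Eventually.of_forall fun y => ?_)
  unfold commKernel
  rw [norm_mul, norm_mul, Complex.norm_real, Complex.norm_real, norm_mul, norm_mul]
  rw [Real.norm_of_nonneg (mul_nonneg (by positivity) (increment_nonneg hf hfb))]
  have := norm_dfHat_le hf hfb (y - x)
  calc _ ≤ ‖(Real.sqrt (2 * Real.pi))⁻¹‖ * ‖(g x - g y) / (x - y)‖ *
        ((Real.sqrt (2 * Real.pi))⁻¹ * increment f) := by gcongr
    _ = _ := by ring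

/-! ### Strong limits, and linearity of the commutator in `f` -/

section

open FourierTransform

/-- `L²` limits and pointwise almost everywhere limits agree. -/
theorem L2R_ae_eq_of_tendsto {u : ℕ → L2R} {u' : L2R} (hu : Tendsto u atTop (𝓝 u'))
    {v : ℕ → ℝ → ℂ} {v' : ℝ → ℂ} (huv : ∀ n, u n =ᵐ[volume] v n)
    (hv : ∀ᵐ x, Tendsto (fun n => v n x) atTop (𝓝 (v' x))) : u' =ᵐ[volume] v' := by
  obtain ⟨ns, hns, hlim⟩ := (tendstoInMeasure_of_tendsto_Lp hu).exists_seq_tendsto_ae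
  filter_upwards [hlim, hv, ae_all_iff.2 huv] with x h1 h2 h3
  have h4 : Tendsto (fun i => v (ns i) x) atTop (𝓝 (v' x)) := h2.comp hns.tendsto_atTop
  simp only [← h3] at h4
  exact tendsto_nhds_unique h1 h4

theorem norm_L2R_sq (ψ : L2R) : ‖ψ‖ ^ 2 = ∫ x, ‖ψ x‖ ^ 2 := by
  have h := L2.inner_def (𝕜 := ℂ) ψ ψ
  rw [inner_self_eq_norm_sq_to_K] at h
  simp only [inner_self_eq_norm_sq_to_K, ← Complex.ofReal_pow, Complex.coe_algebraMap] at h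
  rw [integral_complex_ofReal] at h
  exact Complex.ofReal_injective h

/-- Dominated convergence in `L²`. -/
theorem L2R_tendsto_of_dominated {u : ℕ → L2R} {u' w : L2R}
    (hb : ∀ n, ∀ᵐ x, ‖u n x‖ ≤ ‖w x‖) (h : ∀ᵐ x, Tendsto (fun n => u n x) atTop (𝓝 (u' x))) :
    Tendsto u atTop (𝓝 u') := by
  rw [tendsto_iff_norm_sub_tendsto_zero]
  have key : Tendsto (fun n => ‖u n - u'‖ ^ 2) atTop (𝓝 0) := by
    simp only [norm_L2R_sq]
    have hw : Integrable fun x => (2 * ‖w x‖) ^ 2 := by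
      simp only [mul_pow]
      exact ((memLp_two_iff_integrable_sq_norm (Lp.aestronglyMeasurable w)).1
        (Lp.memLp w)).const_mul _
    have hb' : ∀ᵐ x, ‖u' x‖ ≤ ‖w x‖ := by
      filter_upwards [h, ae_all_iff.2 hb] with x h1 h2
      exact le_of_tendsto h1.norm (Eventually.of_forall h2)
    have := tendsto_integral_of_dominated_convergence (μ := volume)
      (F := fun n x => ‖(u n - u') x‖ ^ 2) (f := fun _ => 0) _ (fun n => by
        exact ((Lp.aestronglyMeasurable (u n - u')).norm.pow 2)) hw ?_ ?_
    · simpa using this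
    · intro n
      filter_upwards [hb n, hb', Lp.coeFn_sub (u n) u'] with x h1 h2 h3
      rw [h3, Pi.sub_apply, Real.norm_of_nonneg (sq_nonneg _)]
      have := norm_sub_le (u n x) (u' x)
      gcongr
      linarith
    · filter_upwards [h, ae_all_iff.2 fun n => Lp.coeFn_sub (u n) u'] with x h1 h2
      simp only [h2, Pi.sub_apply]
      have := (tendsto_iff_norm_sub_tendsto_zero.1 h1).pow 2
      simpa using this
  have := key.sqrt
  simpa [Real.sqrt_sq (norm_nonneg _)] using this

/-- Bounded pointwise convergence of functions gives strong convergence of multiplication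
operators. -/
theorem tendsto_funQ {h : ℕ → ℝ → ℝ} {c M : ℝ} (hm : ∀ n, Measurable (h n))
    (hM : ∀ n x, |h n x| ≤ M) (hlim : ∀ x, Tendsto (fun n => h n x) atTop (𝓝 c)) (ψ : L2R) :
    Tendsto (fun n => funQ (h n) (hm n) ⟨M, hM n⟩ ψ) atTop (𝓝 ((c : ℂ) • ψ)) := by
  refine L2R_tendsto_of_dominated (w := (M : ℂ) • ψ) (fun n => ?_) ?_
  · filter_upwards [funQ_apply (h n) (hm n) ⟨M, hM n⟩ ψ, Lp.coeFn_smul (M : ℂ) ψ] with x h1 h2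
    rw [h1, h2, Pi.smul_apply, smul_eq_mul, norm_mul, norm_mul, Complex.norm_real,
      Complex.norm_real]
    gcongr
    exact (hM n x).trans (le_abs_self M)
  · filter_upwards [ae_all_iff.2 fun n => funQ_apply (h n) (hm n) ⟨M, hM n⟩ ψ,
      Lp.coeFn_smul (c : ℂ) ψ] with x h1 h2
    simp only [h1, h2, Pi.smul_apply, smul_eq_mul]
    exact ((Complex.continuous_ofReal.tendsto _).comp (hlim x)).mul_const _

/-- Conjugating by a unitary preserves strong convergence. Used for the translates `f (· + n)`,
whose operators tend to the scalar `f(∞)`. -/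
theorem tendsto_funP {h : ℕ → ℝ → ℝ} {c M : ℝ} (hm : ∀ n, Measurable (h n))
    (hM : ∀ n x, |h n x| ≤ M) (hlim : ∀ x, Tendsto (fun n => h n x) atTop (𝓝 c)) (ψ : L2R) :
    Tendsto (fun n => funP (h n) (hm n) ⟨M, hM n⟩ ψ) atTop (𝓝 ((c : ℂ) • ψ)) := by
  have h1 := tendsto_funQ (h := fun n ξ => h n (2 * Real.pi * ξ)) (c := c) (M := M)
    (fun n => (hm n).comp (measurable_const_mul (2 * Real.pi))) (fun n ξ => hM n _)
    (fun ξ => hlim _) (Lp.fourierTransformₗᵢ ℝ ℂ ψ)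
  have h2 := ((Lp.fourierTransformₗᵢ ℝ ℂ).symm.continuous.tendsto _).comp h1
  rw [map_smul, LinearIsometryEquiv.symm_apply_apply] at h2
  exact h2

theorem funQ_sub {f f' : ℝ → ℝ} (hm hm' hb hb') (hm'' hb'') :
    funQ f hm hb - funQ f' hm' hb' = funQ (fun x => f x - f' x) hm'' hb'' := by
  ext1 ψ
  refine Lp.ext ?_
  rw [sub_apply]
  filter_upwards [Lp.coeFn_sub (funQ f hm hb ψ) (funQ f' hm' hb' ψ), funQ_apply f hm hb ψ,
    funQ_apply f' hm' hb' ψ, funQ_apply _ hm'' hb'' ψ] with x h1 h2 h3 h4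
  rw [h1, Pi.sub_apply, h2, h3, h4]
  push_cast; ring

theorem funP_sub {f f' : ℝ → ℝ} (hm hm' hb hb') (hm'' hb'') :
    funP f hm hb - funP f' hm' hb' = funP (fun x => f x - f' x) hm'' hb'' := by
  unfold funP
  rw [← ContinuousLinearMap.comp_sub, ← ContinuousLinearMap.sub_comp, funQ_sub]

theorem iCommutator_sub {f f' g : ℝ → ℝ} (hm hm' hb hb') (hm'' hb'') (hg hgb) :
    iCommutator f g hm hb hg hgb - iCommutator f' g hm' hb' hg hgb =
      iCommutator (fun x => f x - f' x) g hm'' hb'' hg hgb := by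
  unfold iCommutator
  rw [← funP_sub hm hm' hb hb', ← smul_sub, ContinuousLinearMap.comp_sub,
    ContinuousLinearMap.sub_comp]
  congr 1
  abel

/-! ### Integrable symbols: `h(P)` as a convolution -/

/-- The convolution kernel of `h(P)`. -/
noncomputable def convKernel (h : ℝ → ℝ) (u : ℝ) : ℂ :=
  ∫ ξ, (h (2 * Real.pi * ξ) : ℂ) * Complex.exp (2 * Real.pi * Complex.I * ξ * u)

theorem integrable_comp_two_pi {h : ℝ → ℝ} (hi : Integrable h) :
    Integrable fun ξ => (h (2 * Real.pi * ξ) : ℂ) :=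
  (hi.comp_mul_left' (by positivity)).ofReal

theorem norm_exp_two_pi (s : ℝ) : ‖Complex.exp (2 * Real.pi * Complex.I * s)‖ = 1 := by
  rw [Complex.norm_exp]; simp

theorem continuous_convKernel {h : ℝ → ℝ} (hi : Integrable h) : Continuous (convKernel h) := by
  refine continuous_of_dominated (bound := fun ξ => ‖(h (2 * Real.pi * ξ) : ℂ)‖) ?_ ?_
    (integrable_comp_two_pi hi).norm ?_
  · intro u
    exact (integrable_comp_two_pi hi).aestronglyMeasurable.mul
      (by fun_prop : Continuous _).aestronglyMeasurable
  · intro u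
    refine Eventually.of_forall fun ξ => ?_
    rw [norm_mul, mul_assoc _ (ξ : ℂ), ← Complex.ofReal_mul, norm_exp_two_pi, mul_one]
  · exact Eventually.of_forall fun ξ => by fun_prop

theorem norm_convKernel_le (h : ℝ → ℝ) (u : ℝ) :
    ‖convKernel h u‖ ≤ ∫ ξ, ‖(h (2 * Real.pi * ξ) : ℂ)‖ := by
  refine (norm_integral_le_integral_norm _).trans_eq (integral_congr_ae ?_)
  refine Eventually.of_forall fun ξ => ?_
  simp only
  rw [norm_mul, mul_assoc _ (ξ : ℂ), ← Complex.ofReal_mul, norm_exp_two_pi, mul_one]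

theorem integrable_convKernel_mul {h : ℝ → ℝ} (hi : Integrable h) {ψ : ℝ → ℂ}
    (hψ : Integrable ψ) (x : ℝ) : Integrable fun y => convKernel h (x - y) * ψ y :=
  hψ.bdd_mul (c := ∫ ξ, ‖(h (2 * Real.pi * ξ) : ℂ)‖)
    ((continuous_convKernel hi).comp (continuous_sub_left x)).aestronglyMeasurable
    (Eventually.of_forall fun _ => norm_convKernel_le h _)

/-- For integrable `h`, the operator `h(P)` is a convolution operator. -/
theorem funP_apply_ae_eq {h : ℝ → ℝ} (hm : Measurable h) (hb : ∃ M, ∀ x, |h x| ≤ M)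
    (hi : Integrable h) (ψ : L2R) (hψ : Integrable ψ) :
    funP h hm hb ψ =ᵐ[volume] fun x => ∫ y, convKernel h (x - y) * ψ y := by
  set w : L2R := funQ (fun ξ => h (2 * Real.pi * ξ)) (hm.comp (measurable_const_mul _))
    (hb.imp fun _ hM ξ => hM (2 * Real.pi * ξ)) (Lp.fourierTransformₗᵢ ℝ ℂ ψ) with hw
  have hw' : w =ᵐ[volume] fun ξ => (h (2 * Real.pi * ξ) : ℂ) * 𝓕 (ψ : ℝ → ℂ) ξ := by
    filter_upwards [funQ_apply (fun ξ => h (2 * Real.pi * ξ))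
      (hm.comp (measurable_const_mul _)) (hb.imp fun _ hM ξ => hM (2 * Real.pi * ξ))
      (Lp.fourierTransformₗᵢ ℝ ℂ ψ), L2R_fourier_ae_eq ψ hψ] with ξ h1 h2
    rw [h1, h2]
  have hcont : Continuous (𝓕 (ψ : ℝ → ℂ)) :=
    VectorFourier.fourierIntegral_continuous Real.continuous_fourierChar continuous_inner hψ
  -- An integrable symbol times the bounded function `𝓕 ψ`; integrability turns the inverse `L²`
  -- transform into an honest integral.
  have hwi : Integrable w := by
    refine Integrable.congr ?_ hw'.symm
    refine (integrable_comp_two_pi hi).mul_bdd (c := ∫ x, ‖ψ x‖) hcont.aestronglyMeasurable ?_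
    exact Eventually.of_forall fun ξ =>
      VectorFourier.norm_fourierIntegral_le_integral_norm _ _ _ _ _
  have h0 : funP h hm hb ψ = (Lp.fourierTransformₗᵢ ℝ ℂ).symm w := rfl
  rw [h0]
  filter_upwards [L2R_fourierInv_ae_eq w hwi] with x hx
  rw [hx, Real.fourierInv_eq']
  have hprod : Integrable (Function.uncurry fun ξ y : ℝ => (h (2 * Real.pi * ξ) : ℂ) * ψ y *
      Complex.exp (2 * Real.pi * Complex.I * (ξ * (x - y) : ℝ))) (volume.prod volume) := by
    refine ((integrable_comp_two_pi hi).mul_prod hψ).mul_bdd (c := 1)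
      (by fun_prop : Continuous _).aestronglyMeasurable ?_
    exact Eventually.of_forall fun p => (norm_exp_two_pi _).le
  have h1 : ∫ ξ, Complex.exp ((2 * Real.pi * inner ℝ ξ x : ℝ) * Complex.I) • w ξ =
      ∫ ξ, ∫ y, (h (2 * Real.pi * ξ) : ℂ) * ψ y *
        Complex.exp (2 * Real.pi * Complex.I * (ξ * (x - y) : ℝ)) := by
    refine integral_congr_ae ?_
    filter_upwards [hw'] with ξ hξ
    rw [hξ, Real.fourier_real_eq_integral_exp_smul, smul_eq_mul, ← integral_const_mul,
      ← integral_const_mul]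
    congr 1 with y
    have : Complex.exp (2 * Real.pi * Complex.I * (ξ * (x - y) : ℝ)) =
        Complex.exp ((2 * Real.pi * inner ℝ ξ x : ℝ) * Complex.I) *
        Complex.exp ((-2 * Real.pi * y * ξ : ℝ) * Complex.I) := by
      rw [← Complex.exp_add]
      congr 1
      simp only [RCLike.inner_apply, conj_trivial]
      push_cast; ring
    rw [this, smul_eq_mul]
    ring
  rw [h1, integral_integral_swap hprod]
  congr 1 with y
  rw [convKernel, ← integral_mul_const]
  congr 1 with ξ
  push_cast
  rw [← mul_assoc]
  ring

/-- In `h(P) g(Q)` the function `g` is evaluated at the integration variable `y`, in `g(Q) h(P)` at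
the output variable `x`. -/
theorem iCommutator_apply_ae_eq_of_integrable {h g : ℝ → ℝ} (hm : Measurable h)
    (hb : ∃ M, ∀ x, |h x| ≤ M) (hg : Measurable g) (hgb : ∃ M, ∀ x, |g x| ≤ M)
    (hi : Integrable h) (ψ : L2R) (hψ : Integrable ψ) :
    iCommutator h g hm hb hg hgb ψ =ᵐ[volume]
      fun x => ∫ y, Complex.I * convKernel h (x - y) * (g y - g x) * ψ y := by
  obtain ⟨M, hM⟩ := id hgb
  have hgψ : Integrable fun x => (g x : ℂ) * ψ x :=
    hψ.bdd_mul (c := M) (Complex.measurable_ofReal.comp hg).aestronglyMeasurable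
      (Eventually.of_forall fun x => by simpa using hM x)
  have hQ := funQ_apply g hg hgb ψ
  have h1 := funP_apply_ae_eq hm hb hi (funQ g hg hgb ψ) (hgψ.congr hQ.symm)
  have h2 := funP_apply_ae_eq hm hb hi ψ hψ
  have h0 : iCommutator h g hm hb hg hgb ψ = Complex.I •
    (funP h hm hb (funQ g hg hgb ψ) - funQ g hg hgb (funP h hm hb ψ)) := rfl
  rw [h0]
  filter_upwards [h1, h2, funQ_apply g hg hgb (funP h hm hb ψ), Lp.coeFn_smul Complex.I
    (funP h hm hb (funQ g hg hgb ψ) - funQ g hg hgb (funP h hm hb ψ)),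
    Lp.coeFn_sub (funP h hm hb (funQ g hg hgb ψ)) (funQ g hg hgb (funP h hm hb ψ))]
    with x e1 e2 e3 e4 e5
  rw [e4, Pi.smul_apply, e5, Pi.sub_apply, e1, e3, e2, smul_eq_mul]
  have e6 : ∫ y, convKernel h (x - y) * funQ g hg hgb ψ y =
      ∫ y, convKernel h (x - y) * (g y * ψ y) :=
    integral_congr_ae (hQ.mono fun y hy => by simp only [hy])
  rw [e6, ← integral_const_mul, ← integral_sub (integrable_convKernel_mul hi hgψ x)
    ((integrable_convKernel_mul hi hψ x).const_mul _), ← integral_const_mul]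
  congr 1 with y
  ring

end

/-! ### The kernel formula -/

theorem norm_exp_I_mul (s : ℝ) : ‖Complex.exp (Complex.I * s)‖ = 1 := by
  rw [Complex.norm_exp]; simp

/-- The inner integral of `integral_sub_mul_eq` for an exponential. The dependence on `η` splits off
as a character, which integrates against `df` to `dfHat (-u)` up to normalisation; the endpoints
leave `1 - e^{-iRu}`. -/
theorem setIntegral_Ico_exp {u : ℝ} (hu : u ≠ 0) {R : ℝ} (hR : 0 ≤ R) (η : ℝ) :
    ∫ ξ in Set.Ico (η - R) η, Complex.exp (Complex.I * (u * ξ : ℝ)) =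
      (1 - Complex.exp (-Complex.I * R * u)) / (Complex.I * u) *
        Complex.exp (-Complex.I * (-u : ℝ) * η) := by
  rw [integral_Ico_eq_integral_Ioc, ← intervalIntegral.integral_of_le (by linarith)]
  have hc : Complex.I * (u : ℂ) ≠ 0 := mul_ne_zero Complex.I_ne_zero (by exact_mod_cast hu)
  have h := integral_exp_mul_complex (a := η - R) (b := η) hc
  have e : (fun ξ : ℝ => Complex.exp (Complex.I * (u * ξ : ℝ))) =
      fun ξ : ℝ => Complex.exp (Complex.I * u * ξ) := by
    ext ξ; push_cast; ring_nf
  rw [e, h, div_mul_eq_mul_div, sub_mul, one_mul, ← Complex.exp_add]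
  congr 3 <;> push_cast <;> ring

theorem integrable_translate_sub {f : ℝ → ℝ} (hf : Monotone f) (hb : ∃ M, ∀ x, |f x| ≤ M)
    {R : ℝ} (hR : 0 ≤ R) : Integrable fun ξ => f ξ - f (ξ + R) := by
  refine (integral_sub_translate hf hb hR).1.neg.congr (Eventually.of_forall fun ξ => ?_)
  simp

/-- The kernel of `i[f(P) - f(P + R), g(Q)]`. -/
theorem convKernel_translate_sub {f : ℝ → ℝ} (hf : Monotone f) (hb : ∃ M, ∀ x, |f x| ≤ M)
    (g : ℝ → ℝ) {R : ℝ} (hR : 0 ≤ R) {x y : ℝ} (hxy : x ≠ y) :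
    Complex.I * convKernel (fun ξ => f ξ - f (ξ + R)) (x - y) * (g y - g x) =
      commKernel hf g x y * (1 - Complex.exp (-Complex.I * R * (x - y))) := by
  set u := x - y with hu
  have hu0 : u ≠ 0 := sub_ne_zero.2 hxy
  have hpi : (0 : ℝ) < 2 * Real.pi := by positivity
  have h1 : convKernel (fun ξ => f ξ - f (ξ + R)) u =
      ((2 * Real.pi)⁻¹ : ℝ) * ∫ ξ, ((f ξ - f (ξ + R) : ℝ) : ℂ) *
        Complex.exp (Complex.I * (u * ξ : ℝ)) := by
    have := Measure.integral_comp_mul_left (fun ξ => ((f ξ - f (ξ + R) : ℝ) : ℂ) *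
        Complex.exp (Complex.I * (u * ξ : ℝ))) (2 * Real.pi)
    rw [abs_of_pos (inv_pos.2 hpi), Complex.real_smul] at this
    rw [← this]
    unfold convKernel
    congr 1 with ξ
    congr 2
    push_cast; ring
  have h2 : ∫ ξ, ((f ξ - f (ξ + R) : ℝ) : ℂ) * Complex.exp (Complex.I * (u * ξ : ℝ)) =
      -((1 - Complex.exp (-Complex.I * R * u)) / (Complex.I * u) *
        (Real.sqrt (2 * Real.pi) * dfHat hf (-u))) := by
    have h3 := (integral_sub_mul_eq hf hb hR
      (φ := fun ξ => Complex.exp (Complex.I * (u * ξ : ℝ))) (by fun_prop : Continuous _).measurable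
      (fun ξ => (norm_exp_I_mul _).le)).2
    simp only [setIntegral_Ico_exp hu0 hR] at h3
    rw [integral_const_mul] at h3
    have hs : ((Real.sqrt (2 * Real.pi) : ℝ) : ℂ) ≠ 0 := by
      exact_mod_cast (Real.sqrt_pos.2 hpi).ne'
    unfold dfHat
    rw [Complex.ofReal_inv, mul_inv_cancel_left₀ hs, ← h3, ← integral_neg]
    congr 1 with ξ
    push_cast; ring
  have hyx : y - x = -u := by rw [hu]; ring
  rw [h1, h2, commKernel, hyx, ← hu]
  have hs : ((Real.sqrt (2 * Real.pi) : ℝ) : ℂ) * (Real.sqrt (2 * Real.pi) : ℝ) =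
      ((2 * Real.pi : ℝ) : ℂ) := by
    rw [← Complex.ofReal_mul, Real.mul_self_sqrt hpi.le]
  have hs0 : ((Real.sqrt (2 * Real.pi) : ℝ) : ℂ) ≠ 0 := by
    exact_mod_cast (Real.sqrt_pos.2 hpi).ne'
  have hu0' : (u : ℂ) ≠ 0 := by exact_mod_cast hu0
  rw [Complex.ofReal_inv, Complex.ofReal_inv, ← hs]
  push_cast
  rw [show ((x : ℂ) - y) = (u : ℂ) by rw [hu]; push_cast; ring]
  field_simp
  ring

/-- The kernel formula on `L¹ ∩ L²`. -/
theorem iCommutator_ae_eq_of_integrable {f g : ℝ → ℝ} (hf : Monotone f) (hg : Monotone g)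
    (hfb : ∃ M, ∀ x, |f x| ≤ M) (hgb : ∃ M, ∀ x, |g x| ≤ M) (ψ : L2R) (hψ : Integrable ψ) :
    iCommutator f g hf.measurable hfb hg.measurable hgb ψ =ᵐ[volume]
      fun x => ∫ y, commKernel hf g x y * ψ y := by
  obtain ⟨M, hM⟩ := id hfb
  have hm : ∀ n : ℕ, Measurable fun ξ => f (ξ + n) := fun n =>
    hf.measurable.comp (measurable_add_const _)
  have hb : ∀ (n : ℕ) ξ, |f (ξ + n)| ≤ M := fun n ξ => hM _
  have hm' : ∀ n : ℕ, Measurable fun ξ => f ξ - f (ξ + n) := fun n => hf.measurable.sub (hm n)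
  have hb' : ∀ n : ℕ, ∃ M, ∀ ξ, |f ξ - f (ξ + n)| ≤ M := fun n =>
    ⟨M + M, fun ξ => (abs_sub _ _).trans (add_le_add (hM _) (hM _))⟩
  have hlim : ∀ ξ, Tendsto (fun n : ℕ => f (ξ + n)) atTop (𝓝 (limUnder atTop f)) := fun ξ =>
    (hf.tendsto_limUnder_atTop hfb).comp
      (tendsto_atTop_add_const_left _ ξ tendsto_natCast_atTop_atTop)
  set C := iCommutator f g hf.measurable hfb hg.measurable hgb with hC
  let D : ℕ → L2R →L[ℂ] L2R := fun n =>
    iCommutator (fun ξ => f (ξ + n)) g (hm n) ⟨M, hb n⟩ hg.measurable hgb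
  -- Both products tend to `f(∞) g(Q) ψ`, so the commutator vanishes in the limit.
  have hD : Tendsto (fun n => D n ψ) atTop (𝓝 0) := by
    have h1 := tendsto_funP hm hb hlim (funQ g hg.measurable hgb ψ)
    have h2 := ((funQ g hg.measurable hgb).continuous.tendsto _).comp (tendsto_funP hm hb hlim ψ)
    have h3 := (h1.sub h2).const_smul Complex.I
    rw [map_smul, sub_self, smul_zero] at h3
    exact h3
  have hCD : Tendsto (fun n => (C - D n) ψ) atTop (𝓝 (C ψ)) := by
    simpa using hD.const_sub (C ψ)
  refine L2R_ae_eq_of_tendsto hCD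
    (v := fun n x => ∫ y, Complex.I * convKernel (fun ξ => f ξ - f (ξ + n)) (x - y) *
      (g y - g x) * ψ y) (fun n => ?_) ?_
  · have h1 : C - D n = iCommutator (fun ξ => f ξ - f (ξ + n)) g (hm' n) (hb' n)
        hg.measurable hgb := iCommutator_sub ..
    rw [h1]
    exact iCommutator_apply_ae_eq_of_integrable (hm' n) (hb' n) hg.measurable hgb
      (integrable_translate_sub hf hfb n.cast_nonneg) ψ hψ
  · filter_upwards [ae_memLp_commKernel hf hfb hg hgb] with x hx
    have hi : Integrable fun y => commKernel hf g x y * ψ y := hx.integrable_mul (Lp.memLp ψ)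
    -- Since `e^{-in(x-y)} = e^{-inx} e^{iny}`, the oscillating part is a unimodular factor times
    -- the Fourier integral of `K(x, ·) ψ` at frequency `-n / 2π`.
    have e : ∀ n : ℕ, ∫ y, Complex.I * convKernel (fun ξ => f ξ - f (ξ + n)) (x - y) *
        (g y - g x) * ψ y = (∫ y, commKernel hf g x y * ψ y) -
          Complex.exp (-Complex.I * n * x) * ∫ y, Real.fourierChar (-(y * (-(n / (2 * Real.pi))))) •
            (commKernel hf g x y * ψ y) := by
      intro n
      rw [← integral_const_mul, ← integral_sub hi ?_]
      · have hne : ∀ᵐ y : ℝ, x ≠ y := by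
          have : ∀ᵐ y : ℝ, y ≠ x := by simp [ae_iff, measure_singleton]
          exact this.mono fun y hy => hy.symm
        refine integral_congr_ae (hne.mono fun y hy => ?_)
        have h1 := convKernel_translate_sub hf hfb g (R := n) n.cast_nonneg hy
        simp only at h1 ⊢
        rw [h1, Circle.smul_def, Real.fourierChar_apply, smul_eq_mul]
        have h2 : Complex.exp (-Complex.I * (n : ℝ) * (x - y)) = Complex.exp (-Complex.I * n * x) *
            Complex.exp ((2 * Real.pi * (-(y * (-(n / (2 * Real.pi))))) : ℝ) * Complex.I) := by
          rw [← Complex.exp_add]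
          congr 1
          push_cast
          have : (Real.pi : ℂ) ≠ 0 := by exact_mod_cast Real.pi_ne_zero
          field_simp
          ring
        rw [h2]
        ring
      · refine Integrable.const_mul ?_ _
        exact (Real.fourierIntegral_convergent_iff (f := fun y => commKernel hf g x y * ψ y)
          (-(n / (2 * Real.pi)) : ℝ)).2 hi |>.congr (Eventually.of_forall fun y => by
            simp [mul_comm])
    simp only [e]
    have hn : Tendsto (fun n : ℕ => (-(n / (2 * Real.pi)) : ℝ)) atTop (cocompact ℝ) := by
      refine (tendsto_neg_atTop_atBot.comp ?_).mono_right atBot_le_cocompact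
      exact tendsto_natCast_atTop_atTop.atTop_div_const (by positivity)
    -- Riemann–Lebesgue lemma.
    have h3 := (Real.tendsto_integral_exp_smul_cocompact
      (fun y => commKernel hf g x y * ψ y)).comp hn
    have h4 : Tendsto (fun n : ℕ => Complex.exp (-Complex.I * n * x) *
        ∫ y, Real.fourierChar (-(y * (-(n / (2 * Real.pi))))) • (commKernel hf g x y * ψ y))
        atTop (𝓝 0) := by
      rw [tendsto_zero_iff_norm_tendsto_zero] at h3 ⊢
      refine h3.congr fun n => ?_
      rw [norm_mul, show -Complex.I * n * x = Complex.I * ((-(n * x) : ℝ) : ℂ) by push_cast; ring,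
        norm_exp_I_mul, one_mul]
      rfl
    simpa using h4.const_sub (∫ y, commKernel hf g x y * ψ y)

/-- The kernel formula for the commutator. -/
theorem iCommutator_ae_eq {f g : ℝ → ℝ} (hf : Monotone f) (hg : Monotone g)
    (hfb : ∃ M, ∀ x, |f x| ≤ M) (hgb : ∃ M, ∀ x, |g x| ≤ M) (ψ : L2R) :
    iCommutator f g hf.measurable hfb hg.measurable hgb ψ =ᵐ[volume]
      fun x => ∫ y, commKernel hf g x y * ψ y := by
  set C := iCommutator f g hf.measurable hfb hg.measurable hgb with hC
  -- Truncations to bounded intervals lie in `L¹ ∩ L²`; the right side converges for each `x` with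
  -- `K(x, ·) ∈ L²`, with dominating function `|K(x, ·) ψ|`.
  let S : ℕ → Set ℝ := fun n => Set.Icc (-n) n
  have hS : ∀ n, MeasurableSet (S n) := fun n => measurableSet_Icc
  have hmem : ∀ n, MemLp ((S n).indicator ψ) 2 := fun n => (Lp.memLp ψ).indicator (hS n)
  have hev : ∀ x, ∀ᶠ n in atTop, x ∈ S n := fun x => by
    obtain ⟨N, hN⟩ := exists_nat_ge |x|
    filter_upwards [eventually_ge_atTop N] with n hn
    have : (N : ℝ) ≤ n := by exact_mod_cast hn
    exact abs_le.1 (hN.trans this)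
  have hlim : ∀ x, Tendsto (fun n => (S n).indicator ψ x) atTop (𝓝 (ψ x)) := fun x =>
    tendsto_const_nhds.congr' ((hev x).mono fun n hn => (Set.indicator_of_mem hn _).symm)
  have hco : ∀ᵐ x, ∀ n, ((hmem n).toLp : L2R) x = (S n).indicator ψ x :=
    ae_all_iff.2 fun n => (hmem n).coeFn_toLp
  have hψ : Tendsto (fun n => (hmem n).toLp) atTop (𝓝 ψ) := by
    refine L2R_tendsto_of_dominated (w := ψ) (fun n => ?_) ?_
    · filter_upwards [hco] with x hx
      rw [hx]
      exact norm_indicator_le_norm_self _ _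
    · filter_upwards [hco] with x hx
      simp only [hx]
      exact hlim x
  have hint : ∀ n, Integrable ((hmem n).toLp) := fun n => by
    refine Integrable.congr ?_ (hmem n).coeFn_toLp.symm
    rw [integrable_indicator_iff (hS n)]
    exact ((Lp.memLp ψ).locallyIntegrable (by norm_num)).integrableOn_isCompact isCompact_Icc
  refine L2R_ae_eq_of_tendsto ((C.continuous.tendsto _).comp hψ)
    (fun n => iCommutator_ae_eq_of_integrable hf hg hfb hgb _ (hint n)) ?_
  filter_upwards [ae_memLp_commKernel hf hfb hg hgb] with x hx
  have hi : Integrable fun y => commKernel hf g x y * ψ y := hx.integrable_mul (Lp.memLp ψ)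
  refine tendsto_integral_of_dominated_convergence (fun y => ‖commKernel hf g x y * ψ y‖)
    (fun n => (hx.aestronglyMeasurable.mul (Lp.aestronglyMeasurable _))) hi.norm (fun n => ?_) ?_
  · filter_upwards [hco] with y hy
    rw [hy, norm_mul, norm_mul]
    gcongr
    exact norm_indicator_le_norm_self _ _
  · filter_upwards [hco] with y hy
    simp only [hy]
    exact (hlim y).const_mul _

/-! ### Hilbert bases, packets and square roots -/

section

open FourierTransform

/-- Orthonormal vectors are `√2` apart, so balls of radius `1/2` around them are disjoint.
Countability is what allows sums over a basis to pass through integrals. -/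
theorem Orthonormal.countable_of_separable {H : Type*} [NormedAddCommGroup H]
    [InnerProductSpace ℂ H] [SecondCountableTopology H] {ι : Type*} {v : ι → H}
    (hv : Orthonormal ℂ v) : Countable ι := by
  have hd : Pairwise fun i j => Disjoint (Metric.ball (v i) (1 / 2)) (Metric.ball (v j) (1 / 2)) := by
    intro i j hij
    refine Metric.ball_disjoint_ball ?_
    have h1 : ‖v i - v j‖ ^ 2 = 2 := by
      have h2 := norm_sub_sq (𝕜 := ℂ) (v i) (v j)
      rw [hv.2 hij, hv.1 i, hv.1 j] at h2
      rw [h2]; norm_num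
    rw [dist_eq_norm]
    nlinarith [norm_nonneg (v i - v j)]
  exact Pairwise.countable_of_isOpen_disjoint hd (fun _ => Metric.isOpen_ball)
    fun i => ⟨v i, Metric.mem_ball_self (by norm_num)⟩

theorem secondCountableTopology_L2R : SecondCountableTopology L2R := by
  have : Fact ((2 : ℝ≥0∞) ≠ ∞) := ⟨by norm_num⟩
  infer_instance

/-- Parseval's identity. -/
theorem HilbertBasis.tsum_enorm_inner_sq {H : Type*} [NormedAddCommGroup H]
    [InnerProductSpace ℂ H] {ι : Type*} (e : HilbertBasis ι ℂ H) (x : H) :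
    ∑' i, ‖⟪x, e i⟫_ℂ‖ₑ ^ 2 = ‖x‖ₑ ^ 2 := by
  have h := e.hasSum_inner_mul_inner x x
  have h1 : ∀ i, ⟪x, e i⟫_ℂ * ⟪e i, x⟫_ℂ = ((‖⟪x, e i⟫_ℂ‖ ^ 2 : ℝ) : ℂ) := fun i => by
    rw [← inner_conj_symm (e i) x, Complex.mul_conj, Complex.normSq_eq_norm_sq]
  rw [inner_self_eq_norm_sq_to_K] at h
  simp only [h1, Complex.coe_algebraMap, ← Complex.ofReal_pow] at h
  have h2 : HasSum (fun i => ‖⟪x, e i⟫_ℂ‖ ^ 2) (‖x‖ ^ 2) := Complex.hasSum_ofReal.1 h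
  have h3 := ENNReal.ofReal_tsum_of_nonneg (fun i => sq_nonneg ‖⟪x, e i⟫_ℂ‖) h2.summable
  rw [h2.tsum_eq] at h3
  simp only [ENNReal.ofReal_pow (norm_nonneg _), ofReal_norm] at h3
  exact h3.symm

/-- The indicator function of the unit interval. -/
noncomputable def box : ℝ → ℂ := (Set.Icc (0 : ℝ) 1).indicator fun _ => 1

theorem measurable_box : Measurable box := measurable_const.indicator measurableSet_Icc

theorem norm_box_le (x : ℝ) : ‖box x‖ ≤ 1 := by
  unfold box Set.indicator
  split_ifs <;> simp

theorem conj_box (x : ℝ) : (starRingEnd ℂ) (box x) = box x := by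
  unfold box Set.indicator
  split_ifs <;> simp

theorem integrable_box : Integrable box := by
  unfold box
  rw [integrable_indicator_iff measurableSet_Icc]
  exact integrableOn_const (by simp)

theorem memLp_box : MemLp box 2 :=
  memLp_indicator_const 2 measurableSet_Icc 1 (Or.inr (by simp))

theorem lintegral_enorm_box_sq : ∫⁻ x, ‖box x‖ₑ ^ 2 = 1 := by
  have : (fun x => ‖box x‖ₑ ^ 2) = (Set.Icc (0 : ℝ) 1).indicator fun _ => 1 := by
    ext x
    unfold box Set.indicator
    split_ifs <;> simp
  rw [this, lintegral_indicator measurableSet_Icc]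
  simp

/-- The indicator function of `[q, q + 1]`, modulated by the frequency `p`. -/
noncomputable def packet (p q x : ℝ) : ℂ :=
  Complex.exp (2 * Real.pi * Complex.I * (p * x : ℝ)) * box (x - q)

theorem norm_packet (p q x : ℝ) : ‖packet p q x‖ = ‖box (x - q)‖ := by
  rw [packet, norm_mul, norm_exp_two_pi, one_mul]

theorem measurable_packet (p q : ℝ) : Measurable (packet p q) :=
  (by fun_prop : Continuous fun x : ℝ =>
    Complex.exp (2 * Real.pi * Complex.I * (p * x : ℝ))).measurable.mul
    (measurable_box.comp (measurable_sub_const q))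

theorem memLp_packet (p q : ℝ) : MemLp (packet p q) 2 :=
  (memLp_box.comp_measurePreserving (measurePreserving_sub_right volume q)).of_le
    (measurable_packet p q).aestronglyMeasurable
    (Eventually.of_forall fun x => (norm_packet p q x).le)

/-- `packet p q` as an element of `L²`. -/
noncomputable def packetLp (p q : ℝ) : L2R := (memLp_packet p q).toLp

theorem inner_packetLp (p q : ℝ) (ψ : L2R) :
    ⟪packetLp p q, ψ⟫_ℂ = ∫ x, (starRingEnd ℂ) (packet p q x) * ψ x := by
  rw [L2.inner_def]
  refine integral_congr_ae ?_
  filter_upwards [(memLp_packet p q).coeFn_toLp] with x hx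
  rw [packetLp, hx, RCLike.inner_apply, mul_comm]

/-- The packet coefficients form a windowed Fourier transform, so Plancherel applies in `p` at each
fixed `q`. -/
theorem inner_packetLp_eq_fourier (p q : ℝ) (ψ : L2R) :
    ⟪packetLp p q, ψ⟫_ℂ = 𝓕 (fun x => box (x - q) * ψ x) p := by
  rw [inner_packetLp, Real.fourier_real_eq_integral_exp_smul]
  congr 1 with x
  rw [packet, map_mul, conj_box, ← Complex.exp_conj, smul_eq_mul, mul_assoc]
  congr 2
  simp only [map_mul, Complex.conj_I, Complex.conj_ofReal, map_ofNat]
  push_cast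
  ring

theorem measurable_inner_packetLp (ψ : L2R) :
    Measurable fun z : ℝ × ℝ => ⟪packetLp z.1 z.2, ψ⟫_ℂ := by
  simp only [inner_packetLp]
  have hm : Measurable fun w : (ℝ × ℝ) × ℝ => (starRingEnd ℂ) (packet w.1.1 w.1.2 w.2) * ψ w.2 := by
    unfold packet
    have h1 : Measurable fun w : (ℝ × ℝ) × ℝ => box (w.2 - w.1.2) :=
      measurable_box.comp (by fun_prop)
    have h2 : Measurable fun w : (ℝ × ℝ) × ℝ => ψ w.2 :=
      (Lp.stronglyMeasurable ψ).measurable.comp measurable_snd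
    exact (Complex.continuous_conj.measurable.comp
      ((by fun_prop : Continuous fun w : (ℝ × ℝ) × ℝ =>
        Complex.exp (2 * Real.pi * Complex.I * (w.1.1 * w.2 : ℝ))).measurable.mul h1)).mul h2
  exact hm.stronglyMeasurable.integral_prod_right'.measurable

/-- The packets form a resolution of the identity. -/
theorem lintegral_inner_packetLp (ψ : L2R) :
    ∫⁻ p, ∫⁻ q, ‖⟪packetLp p q, ψ⟫_ℂ‖ₑ ^ 2 = ‖ψ‖ₑ ^ 2 := by
  rw [lintegral_lintegral_swap
    (((measurable_inner_packetLp ψ).enorm.pow_const 2).aemeasurable)]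
  have hb : ∀ q, MemLp (fun x => box (x - q)) 2 := fun q =>
    memLp_box.comp_measurePreserving (measurePreserving_sub_right volume q)
  -- Plancherel in `p` leaves the squared window at `q`; its translates then integrate to one over
  -- `q`.
  have h1 : ∀ q, ∫⁻ p, ‖⟪packetLp p q, ψ⟫_ℂ‖ₑ ^ 2 = ∫⁻ x, ‖box (x - q)‖ₑ ^ 2 * ‖ψ x‖ₑ ^ 2 := by
    intro q
    simp only [inner_packetLp_eq_fourier]
    rw [lintegral_enorm_fourier_sq (u := fun x => box (x - q) * ψ x)
      ((hb q).integrable_mul (Lp.memLp ψ))]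
    · simp only [enorm_mul, mul_pow]
    · refine (Lp.memLp ψ).of_le ((hb q).aestronglyMeasurable.mul (Lp.aestronglyMeasurable ψ))
        (Eventually.of_forall fun x => ?_)
      rw [norm_mul]
      exact mul_le_of_le_one_left (norm_nonneg _) (norm_box_le _)
  simp only [h1]
  have hbm : Measurable fun z : ℝ × ℝ => ‖box (z.2 - z.1)‖ₑ ^ 2 :=
    (measurable_box.comp (by fun_prop)).enorm.pow_const 2
  have hψm : Measurable fun x => ‖ψ x‖ₑ ^ 2 :=
    (Lp.stronglyMeasurable ψ).measurable.enorm.pow_const 2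
  rw [lintegral_lintegral_swap
    (f := fun q x => ‖box (x - q)‖ₑ ^ 2 * ‖ψ x‖ₑ ^ 2)
    (by exact (hbm.mul (hψm.comp measurable_snd)).aemeasurable), enorm_L2R_sq]
  congr 1 with x
  have hbx : Measurable fun q => ‖box (x - q)‖ₑ ^ 2 :=
    (measurable_box.comp (measurable_const_sub x)).enorm.pow_const 2
  rw [lintegral_mul_const _ hbx,
    lintegral_sub_left_eq_self (fun y => ‖box y‖ₑ ^ 2) x, lintegral_enorm_box_sq, one_mul]

/-- The trace of `S* S` as an integral over packets. -/
theorem tsum_enorm_sq_eq_lintegral_packetLp {S : L2R →L[ℂ] L2R} (hS : IsSelfAdjoint S)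
    {ι : Type*} (e : HilbertBasis ι ℂ L2R) :
    ∑' i, ‖S (e i)‖ₑ ^ 2 = ∫⁻ p, ∫⁻ q, ‖S (packetLp p q)‖ₑ ^ 2 := by
  have := secondCountableTopology_L2R
  have : Countable ι := e.orthonormal.countable_of_separable
  have hsym : ∀ u v, ⟪S u, v⟫_ℂ = ⟪u, S v⟫_ℂ := hS.isSymmetric
  have hm : ∀ ψ, Measurable fun z : ℝ × ℝ => ‖⟪packetLp z.1 z.2, ψ⟫_ℂ‖ₑ ^ 2 := fun ψ =>
    (measurable_inner_packetLp ψ).enorm.pow_const 2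
  -- Expand each `S eᵢ` in packets, move `S` onto the packet by self-adjointness, and sum by
  -- Parseval. All terms are nonnegative, so no finiteness is needed.
  calc ∑' i, ‖S (e i)‖ₑ ^ 2
      = ∑' i, ∫⁻ p, ∫⁻ q, ‖⟪packetLp p q, S (e i)⟫_ℂ‖ₑ ^ 2 := by
        simp only [lintegral_inner_packetLp]
    _ = ∫⁻ p, ∫⁻ q, ∑' i, ‖⟪packetLp p q, S (e i)⟫_ℂ‖ₑ ^ 2 := by
        rw [← lintegral_tsum fun i => (hm (S (e i))).lintegral_prod_right'.aemeasurable]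
        congr 1 with p
        exact (lintegral_tsum fun i =>
          ((hm (S (e i))).comp measurable_prodMk_left).aemeasurable).symm
    _ = ∫⁻ p, ∫⁻ q, ‖S (packetLp p q)‖ₑ ^ 2 := by
        simp only [← hsym, e.tsum_enorm_inner_sq]

/-- The square root of a positive operator. -/
theorem ContinuousLinearMap.IsPositive.exists_sqrt {H : Type*} [NormedAddCommGroup H]
    [InnerProductSpace ℂ H] [CompleteSpace H] {A : H →L[ℂ] H} (hA : A.IsPositive) :
    ∃ S : H →L[ℂ] H, IsSelfAdjoint S ∧ S ∘L S = A ∧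
      ∀ u, ⟪u, A u⟫_ℂ = ((‖S u‖ ^ 2 : ℝ) : ℂ) := by
  have h0 : 0 ≤ A := (ContinuousLinearMap.nonneg_iff_isPositive A).2 hA
  have hS : IsSelfAdjoint (CFC.sqrt A) := (CFC.sqrt_nonneg A).isSelfAdjoint
  have hSS : CFC.sqrt A ∘L CFC.sqrt A = A := CFC.sqrt_mul_sqrt_self A h0
  refine ⟨CFC.sqrt A, hS, hSS, fun u => ?_⟩
  have hsym : ∀ u v, ⟪CFC.sqrt A u, v⟫_ℂ = ⟪u, CFC.sqrt A v⟫_ℂ := hS.isSymmetric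
  have h1 : A u = CFC.sqrt A (CFC.sqrt A u) := congrArg (fun T => T u) hSS.symm
  rw [h1, ← hsym, inner_self_eq_norm_sq_to_K]
  simp

/-- A positive operator with finite trace is trace class. -/
theorem ContinuousLinearMap.IsPositive.isTraceClass_of_hasTrace {H : Type*}
    [NormedAddCommGroup H] [InnerProductSpace ℂ H] [CompleteSpace H] {A : H →L[ℂ] H}
    (hA : A.IsPositive) {t : ℂ} (ht : HasTrace A t) : IsTraceClass A := by
  intro s e
  rw [CFC.abs_of_nonneg A ((ContinuousLinearMap.nonneg_iff_isPositive A).2 hA)]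
  exact (ht s e).summable

end

/-! ### Expectation values of the commutator in packets -/

section

open FourierTransform

/-- The difference quotients of a bounded monotone function over all translates of a pair of
points integrate to its total increment. -/
theorem integral_slope_translate {g : ℝ → ℝ} (hg : Monotone g) (hb : ∃ M, ∀ x, |g x| ≤ M)
    {x y : ℝ} (hxy : x ≠ y) :
    Integrable (fun q => (g (x + q) - g (y + q)) / (x - y)) ∧
    ∫ q, (g (x + q) - g (y + q)) / (x - y) = increment g := by
  wlog h : y < x generalizing x y
  · have h' := this hxy.symm (lt_of_le_of_ne (not_lt.1 h) hxy)
    have e : ∀ q, (g (x + q) - g (y + q)) / (x - y) = (g (y + q) - g (x + q)) / (y - x) := by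
      intro q
      rw [← neg_sub (g (y + q)), ← neg_sub y, neg_div_neg_eq]
    simpa only [e] using h'
  obtain ⟨h1, h2⟩ := integral_sub_translate hg hb (sub_pos.2 h).le
  have e : (fun q => (g (x + q) - g (y + q)) / (x - y)) =
      fun q => (fun ξ => (g (ξ + (x - y)) - g ξ) / (x - y)) (y + q) := by
    ext q
    simp only
    rw [show y + q + (x - y) = x + q by ring]
  rw [e]
  refine ⟨(h1.div_const _).comp_add_left y, ?_⟩
  rw [integral_add_left_eq_self (fun ξ => (g (ξ + (x - y)) - g ξ) / (x - y)), integral_div, h2,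
    mul_div_assoc, div_self (sub_pos.2 h).ne', mul_one]

/-- The factors `x - y` and `dfHat (y - x)` are translation invariant, so averaging over `q` affects
only the increment of `g`. -/
theorem commKernel_translate {f : ℝ → ℝ} (hf : Monotone f) (g : ℝ → ℝ) (x y q : ℝ) :
    commKernel hf g (x + q) (y + q) = ((Real.sqrt (2 * Real.pi))⁻¹ : ℝ) *
      ((g (x + q) - g (y + q)) / (x - y) : ℝ) * dfHat hf (y - x) := by
  rw [commKernel, add_sub_add_right_eq_sub, add_sub_add_right_eq_sub]

theorem slope_nonneg_of_monotone {g : ℝ → ℝ} (hg : Monotone g) (x y : ℝ) :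
    0 ≤ (g x - g y) / (x - y) := by
  rcases le_total x y with h | h
  · exact div_nonneg_of_nonpos (sub_nonpos.2 (hg h)) (sub_nonpos.2 h)
  · exact div_nonneg (sub_nonneg.2 (hg h)) (sub_nonneg.2 h)

theorem ae_fst_ne_snd : ∀ᵐ z : ℝ × ℝ, z.1 ≠ z.2 := by
  rw [ae_iff]
  have hs : MeasurableSet {z : ℝ × ℝ | ¬ z.1 ≠ z.2} := by
    simpa using measurableSet_eq_fun measurable_fst measurable_snd
  rw [Measure.volume_eq_prod, Measure.measure_prod_null hs]
  refine Eventually.of_forall fun x => ?_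
  have : Prod.mk x ⁻¹' {z : ℝ × ℝ | ¬ z.1 ≠ z.2} = {x} := by
    ext y; simp [eq_comm]
  change volume (Prod.mk x ⁻¹' {z : ℝ × ℝ | ¬ z.1 ≠ z.2}) = 0
  rw [this]
  simp

/-- The rank one kernel of the packet at the origin with frequency `p`. -/
noncomputable def packetKernel (p : ℝ) (z : ℝ × ℝ) : ℂ :=
  Complex.exp (2 * Real.pi * Complex.I * (p * (z.2 - z.1) : ℝ)) * (box z.1 * box z.2)

theorem measurable_packetKernel (p : ℝ) : Measurable (packetKernel p) :=
  (by fun_prop : Continuous fun z : ℝ × ℝ =>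
    Complex.exp (2 * Real.pi * Complex.I * (p * (z.2 - z.1) : ℝ))).measurable.mul
    ((measurable_box.comp measurable_fst).mul (measurable_box.comp measurable_snd))

theorem integrable_packetKernel (p : ℝ) : Integrable (packetKernel p) :=
  (integrable_box.mul_prod integrable_box).bdd_mul (c := 1)
    (by fun_prop : Continuous fun z : ℝ × ℝ =>
      Complex.exp (2 * Real.pi * Complex.I * (p * (z.2 - z.1) : ℝ))).aestronglyMeasurable
    (Eventually.of_forall fun _ => (norm_exp_two_pi _).le)

variable {f g : ℝ → ℝ}

/-- Shifting both variables by `q` brings the boxes to the origin, and the phases depend on `y - x`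
only, so `q` survives only in `K`. -/
theorem inner_packetLp_iCommutator (hf : Monotone f) (hg : Monotone g)
    (hfb : ∃ M, ∀ x, |f x| ≤ M) (hgb : ∃ M, ∀ x, |g x| ≤ M) (p q : ℝ) :
    ⟪packetLp p q, iCommutator f g hf.measurable hfb hg.measurable hgb (packetLp p q)⟫_ℂ =
      ∫ x, ∫ y, commKernel hf g (x + q) (y + q) * packetKernel p (x, y) := by
  rw [inner_packetLp, ← integral_add_right_eq_self _ q]
  have h0 := iCommutator_ae_eq hf hg hfb hgb (packetLp p q)
  have h1 := (measurePreserving_add_right volume q).quasiMeasurePreserving.ae h0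
  refine integral_congr_ae (h1.mono fun x hx => ?_)
  simp only at hx ⊢
  rw [hx, ← integral_const_mul, ← integral_add_right_eq_self _ q]
  have h2 := (measurePreserving_add_right volume q).quasiMeasurePreserving.ae
    (memLp_packet p q).coeFn_toLp
  refine integral_congr_ae (h2.mono fun y hy => ?_)
  simp only at hy ⊢
  rw [packetLp, hy, packet, packet, packetKernel, map_mul, conj_box, ← Complex.exp_conj,
    add_sub_cancel_right, add_sub_cancel_right]
  have : Complex.exp (2 * Real.pi * Complex.I * (p * (y - x) : ℝ)) =
      Complex.exp ((starRingEnd ℂ) (2 * Real.pi * Complex.I * (p * (x + q) : ℝ))) *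
      Complex.exp (2 * Real.pi * Complex.I * (p * (y + q) : ℝ)) := by
    rw [← Complex.exp_add]
    congr 1
    simp only [map_mul, Complex.conj_I, Complex.conj_ofReal, map_ofNat]
    push_cast
    ring
  simp only [this]
  ring

/-- Slopes of a monotone function are nonnegative, so the absolute integral over `q` is again `[g]`;
what remains is a bounded factor times an integrable packet kernel. -/
theorem integrable_commKernel_packetKernel (hf : Monotone f) (hg : Monotone g)
    (hfb : ∃ M, ∀ x, |f x| ≤ M) (hgb : ∃ M, ∀ x, |g x| ≤ M) (p : ℝ) :
    Integrable (fun w : (ℝ × ℝ) × ℝ =>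
      commKernel hf g (w.1.1 + w.2) (w.1.2 + w.2) * packetKernel p w.1)
      ((volume : Measure (ℝ × ℝ)).prod volume) := by
  have hK : Measurable fun w : (ℝ × ℝ) × ℝ => commKernel hf g (w.1.1 + w.2) (w.1.2 + w.2) := by
    have h1 := (continuous_dfHat hf hfb).measurable
    have h2 := hg.measurable
    unfold commKernel
    fun_prop
  have hm := hK.mul ((measurable_packetKernel p).comp measurable_fst)
  rw [integrable_prod_iff (by exact hm.aestronglyMeasurable)]
  constructor
  · filter_upwards [ae_fst_ne_snd] with z hz
    simp only [commKernel_translate]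
    exact (((integral_slope_translate hg hgb hz).1.ofReal.const_mul _).mul_const _).mul_const _
  · have hd : Integrable fun z : ℝ × ℝ => (Real.sqrt (2 * Real.pi))⁻¹ * increment g *
        (‖dfHat hf (z.2 - z.1)‖ * ‖packetKernel p z‖) := by
      refine ((integrable_packetKernel p).norm.bdd_mul
        (c := (Real.sqrt (2 * Real.pi))⁻¹ * increment f) ?_ ?_).const_mul _
      · exact ((continuous_dfHat hf hfb).comp
          (by fun_prop : Continuous fun z : ℝ × ℝ => z.2 - z.1)).norm.aestronglyMeasurable
      · exact Eventually.of_forall fun z => by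
          rw [norm_norm]; exact norm_dfHat_le hf hfb _
    refine hd.congr ?_
    filter_upwards [ae_fst_ne_snd] with z hz
    simp only [commKernel_translate, norm_mul, Complex.norm_real,
      Real.norm_of_nonneg (inv_nonneg.2 (Real.sqrt_nonneg (2 * Real.pi)))]
    rw [integral_mul_const, integral_mul_const, integral_const_mul]
    have e : ∀ q, ‖(g (z.1 + q) - g (z.2 + q)) / (z.1 - z.2)‖ =
        (g (z.1 + q) - g (z.2 + q)) / (z.1 - z.2) := fun q => by
      rw [Real.norm_of_nonneg]
      simpa using slope_nonneg_of_monotone hg (z.1 + q) (z.2 + q)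
    have e' := (integral_slope_translate hg hgb hz).2
    rw [← e']
    simp only [e]
    ring

/-- The expectation values of the commutator in the packets of frequency `p`, integrated over
all positions. -/
theorem integral_inner_packetLp_iCommutator (hf : Monotone f) (hg : Monotone g)
    (hfb : ∃ M, ∀ x, |f x| ≤ M) (hgb : ∃ M, ∀ x, |g x| ≤ M) (p : ℝ) :
    Integrable (fun q => ⟪packetLp p q,
      iCommutator f g hf.measurable hfb hg.measurable hgb (packetLp p q)⟫_ℂ) ∧
    ∫ q, ⟪packetLp p q,
      iCommutator f g hf.measurable hfb hg.measurable hgb (packetLp p q)⟫_ℂ =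
      ((Real.sqrt (2 * Real.pi))⁻¹ * increment g : ℝ) *
        ∫ z : ℝ × ℝ, dfHat hf (z.2 - z.1) * packetKernel p z := by
  have hG := integrable_commKernel_packetKernel hf hg hfb hgb p
  have h1 : ∀ᵐ q, (∫ z : ℝ × ℝ, commKernel hf g (z.1 + q) (z.2 + q) * packetKernel p z) =
      ⟪packetLp p q, iCommutator f g hf.measurable hfb hg.measurable hgb (packetLp p q)⟫_ℂ := by
    filter_upwards [hG.prod_left_ae] with q hq
    rw [inner_packetLp_iCommutator hf hg hfb hgb, Measure.volume_eq_prod, integral_prod _ hq]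
  refine ⟨hG.integral_prod_right.congr h1, ?_⟩
  rw [← integral_congr_ae h1, ← integral_integral_swap
    (f := fun (z : ℝ × ℝ) q => commKernel hf g (z.1 + q) (z.2 + q) * packetKernel p z) hG,
    ← integral_const_mul]
  refine integral_congr_ae ?_
  filter_upwards [ae_fst_ne_snd] with z hz
  simp only [commKernel_translate]
  rw [integral_mul_const, integral_mul_const, integral_const_mul, integral_complex_ofReal,
    (integral_slope_translate hg hgb hz).2]
  push_cast
  ring

/-- Once `dfHat` is written as an integral over `η`, the integrand in `z` factors for each `η` into
a Fourier integral of the box times its conjugate, at `s = η / 2π - p`. -/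
theorem integral_dfHat_packetKernel (hf : Monotone f) (hfb : ∃ M, ∀ x, |f x| ≤ M) (p : ℝ) :
    ∫ z : ℝ × ℝ, dfHat hf (z.2 - z.1) * packetKernel p z =
      (((Real.sqrt (2 * Real.pi))⁻¹ *
        ∫ η, ‖𝓕 box (η / (2 * Real.pi) - p)‖ ^ 2 ∂hf.stieltjesFunction.measure : ℝ) : ℂ) := by
  have := isFiniteMeasure_stieltjes hf hfb
  set μ := hf.stieltjesFunction.measure with hμ
  have hexp : ∀ s η : ℝ, ‖Complex.exp (-Complex.I * s * η)‖ = 1 := fun s η => by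
    rw [Complex.norm_exp]; simp
  have hint : Integrable (Function.uncurry fun (z : ℝ × ℝ) (η : ℝ) =>
      Complex.exp (-Complex.I * (z.2 - z.1 : ℝ) * η) * packetKernel p z) (volume.prod μ) := by
    refine ((integrable_packetKernel p).comp_fst μ).bdd_mul (c := 1)
      (by fun_prop : Continuous _).aestronglyMeasurable ?_
    exact Eventually.of_forall fun w => (hexp _ _).le
  have h1 : ∀ z : ℝ × ℝ, dfHat hf (z.2 - z.1) * packetKernel p z =
      ((Real.sqrt (2 * Real.pi))⁻¹ : ℝ) *
        ∫ η, Complex.exp (-Complex.I * (z.2 - z.1 : ℝ) * η) * packetKernel p z ∂μ := fun z => by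
    rw [dfHat, integral_mul_const, mul_assoc]
  have h2 : ∀ η : ℝ, ∫ z : ℝ × ℝ, Complex.exp (-Complex.I * (z.2 - z.1 : ℝ) * η) * packetKernel p z =
      ((‖𝓕 box (η / (2 * Real.pi) - p)‖ ^ 2 : ℝ) : ℂ) := fun η => by
    set s := η / (2 * Real.pi) - p with hs
    have hη : η = 2 * Real.pi * (s + p) := by
      rw [hs]; field_simp; ring
    have h3 : 𝓕 box s = ∫ x, Complex.exp ((-2 * Real.pi * x * s : ℝ) * Complex.I) * box x := by
      rw [Real.fourier_real_eq_integral_exp_smul]; rfl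
    have h4 : (starRingEnd ℂ) (𝓕 box s) =
        ∫ x, Complex.exp ((2 * Real.pi * x * s : ℝ) * Complex.I) * box x := by
      rw [h3, ← integral_conj]
      congr 1 with x
      rw [map_mul, conj_box, ← Complex.exp_conj]
      congr 2
      simp only [map_mul, Complex.conj_I, Complex.conj_ofReal]
      push_cast; ring
    rw [Complex.ofReal_pow, ← Complex.conj_mul', h4, h3, ← integral_prod_mul,
      Measure.volume_eq_prod]
    refine integral_congr_ae (Eventually.of_forall fun z => ?_)
    simp only
    rw [packetKernel, hη]
    have h5 : Complex.exp (-Complex.I * (z.2 - z.1 : ℝ) * (2 * Real.pi * (s + p) : ℝ)) *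
        Complex.exp (2 * Real.pi * Complex.I * (p * (z.2 - z.1) : ℝ)) =
        Complex.exp ((2 * Real.pi * z.1 * s : ℝ) * Complex.I) *
        Complex.exp ((-2 * Real.pi * z.2 * s : ℝ) * Complex.I) := by
      rw [← Complex.exp_add, ← Complex.exp_add]
      congr 1
      push_cast
      ring
    rw [← mul_assoc, h5]
    ring
  simp only [h1]
  rw [integral_const_mul, integral_integral_swap hint]
  simp only [h2]
  rw [integral_complex_ofReal]
  push_cast
  rfl

theorem continuous_fourier_box : Continuous (𝓕 box) :=
  VectorFourier.fourierIntegral_continuous Real.continuous_fourierChar continuous_inner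
    integrable_box

theorem norm_fourier_box_le (s : ℝ) : ‖𝓕 box s‖ ≤ ∫ x, ‖box x‖ :=
  VectorFourier.norm_fourierIntegral_le_integral_norm _ _ _ _ _

/-- The sum over a Hilbert basis of the expectation values of the commutator. -/
theorem tsum_enorm_sqrt_iCommutator (hf : Monotone f) (hg : Monotone g)
    (hfb : ∃ M, ∀ x, |f x| ≤ M) (hgb : ∃ M, ∀ x, |g x| ≤ M) {S : L2R →L[ℂ] L2R}
    (hS : IsSelfAdjoint S)
    (hSC : ∀ u, ⟪u, iCommutator f g hf.measurable hfb hg.measurable hgb u⟫_ℂ =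
      ((‖S u‖ ^ 2 : ℝ) : ℂ)) {ι : Type*} (e : HilbertBasis ι ℂ L2R) :
    ∑' i, ‖S (e i)‖ₑ ^ 2 = ENNReal.ofReal (increment f * increment g / (2 * Real.pi)) := by
  have := isFiniteMeasure_stieltjes hf hfb
  set μ := hf.stieltjesFunction.measure with hμ
  have hpi : (0 : ℝ) < 2 * Real.pi := by positivity
  have hg0 := increment_nonneg hg hgb
  have hf0 := increment_nonneg hf hfb
  have hi : ∀ p, Integrable (fun η => ‖𝓕 box (η / (2 * Real.pi) - p)‖ ^ 2) μ := fun p => by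
    refine Integrable.of_bound (C := (∫ x, ‖box x‖) ^ 2)
      ((continuous_fourier_box.comp (by fun_prop)).norm.pow 2).aestronglyMeasurable
      (Eventually.of_forall fun η => ?_)
    rw [Real.norm_of_nonneg (sq_nonneg _)]
    exact pow_le_pow_left₀ (norm_nonneg _) (norm_fourier_box_le _) 2
  have h1 : ∀ p, ∫⁻ q, ‖S (packetLp p q)‖ₑ ^ 2 = ENNReal.ofReal (increment g / (2 * Real.pi)) *
      ∫⁻ η, ‖𝓕 box (η / (2 * Real.pi) - p)‖ₑ ^ 2 ∂μ := fun p => by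
    obtain ⟨a, b⟩ := integral_inner_packetLp_iCommutator hf hg hfb hgb p
    simp only [hSC] at a b
    have a' : Integrable fun q => ‖S (packetLp p q)‖ ^ 2 :=
      a.re.congr (Eventually.of_forall fun q => Complex.ofReal_re _)
    rw [integral_complex_ofReal, integral_dfHat_packetKernel hf hfb, ← Complex.ofReal_mul] at b
    have b' := Complex.ofReal_injective b
    have c := ofReal_integral_eq_lintegral_ofReal a' (Eventually.of_forall fun q => sq_nonneg _)
    have d := ofReal_integral_eq_lintegral_ofReal (hi p)
      (Eventually.of_forall fun q => sq_nonneg _)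
    simp only [ENNReal.ofReal_pow (norm_nonneg _), ofReal_norm] at c d
    rw [← c, ← d, b', ← ENNReal.ofReal_mul (by positivity)]
    congr 1
    -- One factor comes from the normalisation of `K`, the other from that of `dfHat`.
    have hs : (Real.sqrt (2 * Real.pi))⁻¹ * (Real.sqrt (2 * Real.pi))⁻¹ = (2 * Real.pi)⁻¹ := by
      rw [← mul_inv, Real.mul_self_sqrt hpi.le]
    rw [div_eq_mul_inv, ← hs]
    ring
  rw [tsum_enorm_sq_eq_lintegral_packetLp hS]
  simp only [h1]
  have hm : Measurable fun z : ℝ × ℝ => ‖𝓕 box (z.2 / (2 * Real.pi) - z.1)‖ₑ ^ 2 :=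
    (continuous_fourier_box.comp (by fun_prop)).measurable.enorm.pow_const 2
  rw [lintegral_const_mul _ (by exact hm.lintegral_prod_right'), lintegral_lintegral_swap
    (f := fun p η => ‖𝓕 box (η / (2 * Real.pi) - p)‖ₑ ^ 2) (by exact hm.aemeasurable)]
  -- Integrating over all frequencies removes the dependence on `η`, so only the mass `[f]` of `df`
  -- remains.
  have h2 : ∀ η, ∫⁻ p, ‖𝓕 box (η / (2 * Real.pi) - p)‖ₑ ^ 2 = 1 := fun η => by
    rw [lintegral_sub_left_eq_self (fun p => ‖𝓕 box p‖ₑ ^ 2),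
      lintegral_enorm_fourier_sq integrable_box memLp_box, lintegral_enorm_box_sq]
  simp only [h2]
  rw [lintegral_const, one_mul, stieltjes_measure_univ hf hfb, ← ENNReal.ofReal_mul (by positivity)]
  congr 1
  ring

end

/-! ### Hilbert–Schmidt norm and conclusion -/

theorem hasSum_of_tsum_enorm_sq {E : Type*} [NormedAddCommGroup E] {ι : Type*} {v : ι → E} {t : ℝ}
    (ht : 0 ≤ t) (h : ∑' i, ‖v i‖ₑ ^ 2 = ENNReal.ofReal t) : HasSum (fun i => ‖v i‖ ^ 2) t := by
  have h1 : Summable fun i => ((‖v i‖ₑ ^ 2).toReal) :=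
    ENNReal.summable_toReal (by rw [h]; exact ENNReal.ofReal_ne_top)
  have h2 : ∑' i, (‖v i‖ₑ ^ 2).toReal = t := by
    rw [← ENNReal.tsum_toReal_eq fun i => by simp, h, ENNReal.toReal_ofReal ht]
  have h3 := h1.hasSum
  rw [h2] at h3
  simpa using h3

/-- The Hilbert–Schmidt norm of an integral operator whose kernel has square integrable sections
is the `L²` norm of its kernel. -/
theorem lintegral_enorm_kernel_sq {K : ℝ × ℝ → ℂ} (hK : Measurable K)
    (hKx : ∀ᵐ x, MemLp (fun y => K (x, y)) 2) {T : L2R →L[ℂ] L2R}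
    (hT : ∀ ψ : L2R, T ψ =ᵐ[volume] fun x => ∫ y, K (x, y) * ψ y) {ι : Type*} [Countable ι]
    (e : HilbertBasis ι ℂ L2R) : ∫⁻ z, ‖K z‖ₑ ^ 2 = ∑' i, ‖T (e i)‖ₑ ^ 2 := by
  rw [Measure.volume_eq_prod, lintegral_prod _ (by exact (hK.enorm.pow_const 2).aemeasurable)]
  simp only [enorm_L2R_sq]
  rw [← lintegral_tsum fun i =>
    ((Lp.stronglyMeasurable (T (e i))).measurable.enorm.pow_const 2).aemeasurable]
  refine lintegral_congr_ae ?_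
  filter_upwards [hKx, ae_all_iff.2 fun i => hT (e i)] with x hx hTx
  have hs : MemLp (fun y => (starRingEnd ℂ) (K (x, y))) 2 := hx.star
  -- At fixed `x`, these are the coefficients of the conjugate section of `K`, so Parseval sums
  -- their squares to its `L²` norm squared.
  have h1 : ∀ i, T (e i) x = ⟪(hs.toLp : L2R), e i⟫_ℂ := fun i => by
    rw [hTx, L2.inner_def]
    refine integral_congr_ae (hs.coeFn_toLp.mono fun y hy => ?_)
    simp only [hy, RCLike.inner_apply, Complex.conj_conj]
    ring
  simp only [h1]
  rw [e.tsum_enorm_inner_sq, enorm_L2R_sq]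
  refine lintegral_congr_ae (hs.coeFn_toLp.mono fun y hy => ?_)
  simp only [hy, RCLike.enorm_conj]

theorem mainTheorem5 (f g : ℝ → ℝ) (hf : Monotone f) (hg : Monotone g)
    (hfb : ∃ M, ∀ x, |f x| ≤ M) (hgb : ∃ M, ∀ x, |g x| ≤ M)
    (hC : (iCommutator f g hf.measurable hfb hg.measurable hgb).IsPositive) :
    (∀ ψ : L2R, ∀ᵐ x : ℝ,
      Integrable (fun y => commKernel hf g x y * ψ y) ∧
      iCommutator f g hf.measurable hfb hg.measurable hgb ψ x =
        ∫ y, commKernel hf g x y * ψ y) ∧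
    MemLp (fun p : ℝ × ℝ => commKernel hf g p.1 p.2) 2 volume ∧
    IsTraceClass (iCommutator f g hf.measurable hfb hg.measurable hgb) ∧
    HasTrace (iCommutator f g hf.measurable hfb hg.measurable hgb)
      ((increment f * increment g / (2 * Real.pi) : ℝ) : ℂ) := by
  obtain ⟨S, hS, hSS, hSC⟩ := hC.exists_sqrt
  have ht : 0 ≤ increment f * increment g / (2 * Real.pi) :=
    div_nonneg (mul_nonneg (increment_nonneg hf hfb) (increment_nonneg hg hgb)) (by positivity)
  have hsum : ∀ {s : Set L2R} (e : HilbertBasis s ℂ L2R), ∑' i, ‖S (e i)‖ₑ ^ 2 = _ := fun e =>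
    tsum_enorm_sqrt_iCommutator hf hg hfb hgb hS hSC e
  have htr : HasTrace (iCommutator f g hf.measurable hfb hg.measurable hgb)
      ((increment f * increment g / (2 * Real.pi) : ℝ) : ℂ) := fun s e => by
    simp only [hSC]
    exact Complex.hasSum_ofReal.2 (hasSum_of_tsum_enorm_sq ht (hsum e))
  refine ⟨fun ψ => ?_, ?_, hC.isTraceClass_of_hasTrace htr, htr⟩
  · filter_upwards [ae_memLp_commKernel hf hfb hg hgb, iCommutator_ae_eq hf hg hfb hgb ψ]
      with x hx hψ
    exact ⟨hx.integrable_mul (Lp.memLp ψ), hψ⟩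
  · have hm := measurable_commKernel hf hfb hg.measurable
    obtain ⟨s, e, -⟩ := exists_hilbertBasis ℂ L2R
    have := secondCountableTopology_L2R
    have : Countable s := e.orthonormal.countable_of_separable
    have hHS := lintegral_enorm_kernel_sq hm (ae_memLp_commKernel hf hfb hg hgb)
      (iCommutator_ae_eq hf hg hfb hgb) e
    refine ⟨hm.aestronglyMeasurable, ?_⟩
    rw [eLpNorm_lt_top_iff_lintegral_rpow_enorm_lt_top (by norm_num) (by norm_num)]
    simp only [ENNReal.toReal_ofNat, ENNReal.rpow_ofNat]
    rw [hHS]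
    -- `C = S ∘ S` gives `‖C eᵢ‖ ≤ ‖S‖ ‖S eᵢ‖`, and `∑ ‖S eᵢ‖²` is the finite trace.
    calc ∑' i, ‖iCommutator f g hf.measurable hfb hg.measurable hgb (e i)‖ₑ ^ 2
        ≤ ∑' i, ‖S‖ₑ ^ 2 * ‖S (e i)‖ₑ ^ 2 := by
          refine ENNReal.tsum_le_tsum fun i => ?_
          rw [← hSS, ContinuousLinearMap.comp_apply, ← mul_pow]
          exact pow_le_pow_left' (S.le_opENorm _) 2
      _ < ∞ := by
          rw [ENNReal.tsum_mul_left, hsum e]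
          exact ENNReal.mul_lt_top (by simp) ENNReal.ofReal_lt_top
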